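/- Let $k$ be a commutative artinian ring and $R$ an artin $k$-algebra (a $k$-algebra that is finitely generated as a $k$-module). Modules are right modules unless a left action is indicated, $\mathrm{mod}\,R$ is the category of finitely generated right $R$-modules, and $D=\mathrm{Hom}_k(-,E)$, where $E$ is the injective envelope of $k/\mathrm{rad}\,k$. All subcategories are full. **Definitions.** - For $T\in\mathrm{mod}\,R$ put $S=\mathrm{End}(T_R)$, so that $T$ is an $S$-$R$-bimodule and $DT$ is an $R$-$S$-bimodule. $T$ is *Wakamatsu-tilting* if the canonical map $R\to\mathrm{End}({}_ST)$ (endomorphisms of ${}_ST$ acting on the right) is an isomorphism and $\mathrm{Ext}^i_R(T,T)=0=\mathrm{Ext}^i_S(T,T)$ for all $i>0$. - A subcategory of $\mathrm{mod}\,R$ is *resolving* if it contains the finitely generated projective modules and is closed under extensions, kernels of epimorphisms and direct summands. It is *coresolving* if it contains the finitely generated injective modules and is closed under extensions, cokernels of monomorphisms and direct summands. - A subcategory $\mathcal A$ of $\mathrm{mod}\,R$ is *covariantly finite* if every $X\in\mathrm{mod}\,R$ admits a map $X\to A_X$ with $A_X\in\mathcal A$ through which every map from $X$ to an object of $\mathcal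 A$ factors. *Contravariantly finite* is dual. - $T$ is an *Ext-projective generator* of $\mathcal A$ if $T\in\mathcal A$, $\mathrm{Ext}^1_R(T,A)=0$ for all $A\in\mathcal A$, and every $A\in\mathcal A$ has an exact sequence $0\to A'\to T_A\to A\to 0$ with $A'\in\mathcal A$ and $T_A\in\mathrm{add}\,T$ (direct summands of finite direct sums of copies of $T$). - A pair $(\mathcal B,\mathcal A)$ of subcategories of $\mathrm{mod}\,R$ is a *cotorsion pair* if $\mathcal B=\{X\in\mathrm{mod}\,R:\mathrm{Ext}^1_R(X,\mathcal A)=0\}$ and $\mathcal A=\{Y\in\mathrm{mod}\,R:\mathrm{Ext}^1_R(\mathcal B,Y)=0\}$. It is *hereditary* if $\mathcal B$ is resolving. It is *complete* if every $X\in\mathrm{mod}\,R$ has exact sequences $0\to X\to A\to B\to0$ and $0\to A'\to B'\to X\to 0$ with $A,A'\in\mathcal A$ and $B,B'\in\mathcal B$. The same definitions apply to $\mathrm{mod}\,S$. - A Wakamatsu-tilting module $T$ with $S=\mathrm{End}(T_R)$ is *good* if there are complete hereditary cotorsion pairs $(\mathcal B,\mathcal A)$ in $\mathrm{mod}\,R$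 and $(\mathcal G,\mathcal K)$ in $\mathrm{mod}\,S$ such that $\mathrm{Hom}_R(T,-):\mathcal A\rightleftarrows\mathcal G:-\otimes_ST$ and $\mathrm{Hom}_S(DT,-):\mathcal K\rightleftarrows\mathcal B:-\otimes_RDT$ are pairs of mutually quasi-inverse equivalences. **Statement.** Let $T$ be a Wakamatsu-tilting $R$-module with $S=\mathrm{End}(T_R)$. Suppose that $\mathrm{Hom}_R(T,-)$ restricts to an equivalence from a covariantly finite coresolving subcategory $\mathcal A$ of $\mathrm{mod}\,R$ to a contravariantly finite resolving subcategory $\mathcal G$ of $\mathrm{mod}\,S$. If $T$ is an Ext-projective generator of $\mathcal A$, then $T$ is a good Wakamatsu-tilting module. -/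

import Mathlib

open CategoryTheory Abelian
open scoped TensorProduct

universe u

noncomputable section

/-! ### Injective envelopes and the duality of an artin algebra -/

/-- An injective linear map `i : M → E` is an injective envelope if `E` is injective and the image
of `i` is an essential submodule of `E`. -/
structure IsInjectiveEnvelope {k M E : Type u} [CommRing k] [AddCommGroup M] [Module k M]
    [AddCommGroup E] [Module k E] (i : M →ₗ[k] E) : Prop where
  injective : Function.Injective i
  injective_module : Module.Injective k E
  essential : ∀ N : Submodule k E, N ⊓ LinearMap.range i = ⊥ → N = ⊥

theorem exists_maximal_disjoint {k I : Type u} [CommRing k] [AddCommGroup I] [Module k I]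
    (P Q : Submodule k I) (h : Disjoint P Q) :
    ∃ C : Submodule k I, Q ≤ C ∧ Disjoint P C ∧
      ∀ D : Submodule k I, C ≤ D → Disjoint P D → D = C := by
  obtain ⟨C, hQC, hC⟩ := zorn_le_nonempty₀ {D : Submodule k I | Disjoint P D}
    (by
      intro c hc hchain y hy
      refine ⟨sSup c, ?_, fun z hz => le_sSup hz⟩
      exact (DirectedOn.disjoint_sSup_right hchain.directedOn).2 (fun b hb => hc hb))
    Q h
  exact ⟨C, hQC, hC.prop, fun D hCD hD => le_antisymm (hC.le_of_ge hD hCD) hCD⟩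

theorem exists_injectiveEnvelope (k M : Type u) [CommRing k] [AddCommGroup M] [Module k M] :
    ∃ (E : ModuleCat.{u} k) (i : M →ₗ[k] E), IsInjectiveEnvelope i := by
  obtain ⟨⟨I, hI, f, hf⟩⟩ := EnoughInjectives.presentation (ModuleCat.of k M)
  have hIm : Module.Injective k I := Module.injective_module_of_injective_object k I
  have hfinj : Function.Injective f.hom := (ModuleCat.mono_iff_injective f).1 hf
  set P : Submodule k I := LinearMap.range f.hom with hP
  obtain ⟨C, -, hPC, hCmax⟩ := exists_maximal_disjoint P ⊥ disjoint_bot_right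
  obtain ⟨E, hPE, hCE, hEmax⟩ := exists_maximal_disjoint C P hPC.symm
  -- `C` is also maximal among the submodules disjoint from `E`
  have hC' : ∀ D : Submodule k I, C ≤ D → Disjoint E D → D = C := fun D hCD hD =>
    hCmax D hCD (hD.mono_left hPE)
  let q : E →ₗ[k] (I ⧸ C) := C.mkQ.comp E.subtype
  have hq : Function.Injective q := by
    rw [injective_iff_map_eq_zero]
    intro x hx
    have h1 : (x : I) ∈ C := by simpa [q] using hx
    exact Subtype.ext (Submodule.disjoint_def.1 hCE _ h1 x.2)
  obtain ⟨g, hg⟩ := hIm.out q hq E.subtype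
  -- the extension `g` is injective and its image is `E`
  let G : I →ₗ[k] I := g.comp C.mkQ
  have hGC : ∀ c ∈ C, G c = 0 := fun c hc => by
    have : C.mkQ c = 0 := by simpa using hc
    simp only [G, LinearMap.comp_apply, this, map_zero]
  have hGE : ∀ e ∈ E, G e = e := fun e he => hg ⟨e, he⟩
  have hcomap : C.comap G = C := by
    refine hC' _ (fun c hc => by simp [hGC c hc]) ?_
    rw [Submodule.disjoint_def]
    intro x hxE hx
    have h1 : G x ∈ C := hx
    rw [hGE x hxE] at h1
    exact Submodule.disjoint_def.1 hCE x h1 hxE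
  have hrange : LinearMap.range G = E := by
    refine hEmax _ (fun e he => ⟨e, hGE e he⟩) ?_
    rw [Submodule.disjoint_def]
    rintro _ hxC ⟨x, rfl⟩
    have h1 : x ∈ C.comap G := hxC
    rw [hcomap] at h1
    exact hGC x h1
  let r : I →ₗ[k] E := G.codRestrict E (fun x => hrange ▸ LinearMap.mem_range_self G x)
  have hr : ∀ e : E, r e = e := fun e => Subtype.ext (hGE e e.2)
  refine ⟨ModuleCat.of k E, f.hom.codRestrict E (fun m => hPE ⟨m, rfl⟩), ?_, ?_, ?_⟩
  · intro a b hab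
    exact hfinj (congrArg Subtype.val hab)
  · refine ⟨fun X Y _ _ _ _ a ha b => ?_⟩
    obtain ⟨h, hh⟩ := hIm.out a ha (E.subtype.comp b)
    refine ⟨r.comp h, fun x => ?_⟩
    have h1 : h (a x) = ((b x : E) : I) := hh x
    rw [LinearMap.comp_apply, h1]
    exact hr _
  · intro N hN
    have hN' : N.map E.subtype ≤ C := by
      rw [← sup_eq_right, sup_comm]
      refine hCmax _ le_sup_left ?_
      rw [Submodule.disjoint_def]
      intro x hxP hx
      obtain ⟨c, hc, n, ⟨n, hn, rfl⟩, rfl⟩ := Submodule.mem_sup.1 hx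
      have hcE : c ∈ E := by
        have := E.sub_mem (hPE hxP) n.2
        simpa using this
      have hc0 : c = 0 := Submodule.disjoint_def.1 hCE c hc hcE
      subst hc0
      obtain ⟨m, hm⟩ := hxP
      have hnmem : n ∈ N ⊓ LinearMap.range
          (f.hom.codRestrict E (fun m => hPE ⟨m, rfl⟩)) :=
        ⟨hn, m, Subtype.ext (by simpa using hm)⟩
      rw [hN] at hnmem
      have : n = 0 := hnmem
      simp [this]
    rw [eq_bot_iff]
    intro n hn
    have h1 : (n : I) ∈ C := hN' ⟨n, hn, rfl⟩
    exact Subtype.ext (Submodule.disjoint_def.1 hCE _ h1 n.2)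

/-- The injective envelope of `k / rad k` over a commutative ring `k`. -/
def dualizingModule (k : Type u) [CommRing k] : ModuleCat.{u} k :=
  (exists_injectiveEnvelope k (k ⧸ Ring.jacobson k)).choose

/-- The embedding of `k / rad k` into its injective envelope. -/
def dualizingEmbedding (k : Type u) [CommRing k] :
    (k ⧸ Ring.jacobson k) →ₗ[k] dualizingModule k :=
  (exists_injectiveEnvelope k (k ⧸ Ring.jacobson k)).choose_spec.choose

theorem isInjectiveEnvelope_dualizingEmbedding (k : Type u) [CommRing k] :
    IsInjectiveEnvelope (dualizingEmbedding k) :=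
  (exists_injectiveEnvelope k (k ⧸ Ring.jacobson k)).choose_spec.choose_spec

/-- The dual `DV = Hom_k(V, E)`, where `E` is the injective envelope of `k / rad k`. -/
def ArtinDual (k V : Type u) [CommRing k] [AddCommGroup V] [Module k V] : Type u :=
  V →ₗ[k] dualizingModule k

namespace ArtinDual

variable (k R S V : Type u) [CommRing k] [Ring R] [Ring S] [AddCommGroup V] [Module k V]

instance : AddCommGroup (ArtinDual k V) :=
  inferInstanceAs (AddCommGroup (V →ₗ[k] dualizingModule k))

instance : FunLike (ArtinDual k V) V (dualizingModule k) :=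
  inferInstanceAs (FunLike (V →ₗ[k] dualizingModule k) V (dualizingModule k))

instance : AddMonoidHomClass (ArtinDual k V) V (dualizingModule k) :=
  inferInstanceAs (AddMonoidHomClass (V →ₗ[k] dualizingModule k) V (dualizingModule k))

/-- For a right `R`-module `V`, the dual `DV` is a left `R`-module: `(r f)(v) = f(v r)`. -/
instance leftModule [Module Rᵐᵒᵖ V] [SMulCommClass Rᵐᵒᵖ k V] : Module R (ArtinDual k V) where
  smul r f := LinearMap.comp (f : V →ₗ[k] dualizingModule k)
    (DistribSMul.toLinearMap k V (MulOpposite.op r))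
  one_smul f := DFunLike.ext _ _ fun v => congrArg f (one_smul Rᵐᵒᵖ v)
  mul_smul r s f := DFunLike.ext _ _ fun v =>
    congrArg f (mul_smul (MulOpposite.op s) (MulOpposite.op r) v)
  smul_zero _ := rfl
  smul_add _ _ _ := rfl
  add_smul r s f := DFunLike.ext _ _ fun v =>
    (congrArg f (add_smul (MulOpposite.op r) (MulOpposite.op s) v)).trans (map_add f _ _)
  zero_smul f := DFunLike.ext _ _ fun v => (congrArg f (zero_smul Rᵐᵒᵖ v)).trans (map_zero f)

/-- For a left `S`-module `V`, the dual `DV` is a right `S`-module: `(f s)(v) = f(s v)`. -/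
instance rightModule [Module S V] [SMulCommClass S k V] : Module Sᵐᵒᵖ (ArtinDual k V) where
  smul s f := LinearMap.comp (f : V →ₗ[k] dualizingModule k)
    (DistribSMul.toLinearMap k V s.unop)
  one_smul f := DFunLike.ext _ _ fun v => congrArg f (one_smul S v)
  mul_smul r s f := DFunLike.ext _ _ fun v => congrArg f (mul_smul s.unop r.unop v)
  smul_zero _ := rfl
  smul_add _ _ _ := rfl
  add_smul r s f := DFunLike.ext _ _ fun v =>
    (congrArg f (add_smul r.unop s.unop v)).trans (map_add f _ _)
  zero_smul f := DFunLike.ext _ _ fun v => (congrArg f (zero_smul S v)).trans (map_zero f)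

instance smulCommClass [Module Rᵐᵒᵖ V] [SMulCommClass Rᵐᵒᵖ k V] [Module S V] [SMulCommClass S k V]
    [SMulCommClass S Rᵐᵒᵖ V] : SMulCommClass R Sᵐᵒᵖ (ArtinDual k V) where
  smul_comm r s f := DFunLike.ext _ _ fun v =>
    congrArg f (smul_comm s.unop (MulOpposite.op r) v)

end ArtinDual

/-! ### The functors `Hom_R(V, -)` and `- ⊗_S V` of an `S`-`R`-bimodule `V`

Right modules over `R` are modules over `Rᵐᵒᵖ`. -/

/-- `Hom_R(V, M)` for an `S`-`R`-bimodule `V` and a right `R`-module `M`. -/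
def BimodHom (R V M : Type u) [Ring R] [AddCommGroup V] [Module Rᵐᵒᵖ V]
    [AddCommGroup M] [Module Rᵐᵒᵖ M] : Type u := V →ₗ[Rᵐᵒᵖ] M

namespace BimodHom

variable (S R V : Type u) [Ring S] [Ring R] [AddCommGroup V] [Module S V] [Module Rᵐᵒᵖ V]

instance (M : Type u) [AddCommGroup M] [Module Rᵐᵒᵖ M] : AddCommGroup (BimodHom R V M) :=
  inferInstanceAs (AddCommGroup (V →ₗ[Rᵐᵒᵖ] M))

instance (M : Type u) [AddCommGroup M] [Module Rᵐᵒᵖ M] : FunLike (BimodHom R V M) V M :=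
  inferInstanceAs (FunLike (V →ₗ[Rᵐᵒᵖ] M) V M)

instance (M : Type u) [AddCommGroup M] [Module Rᵐᵒᵖ M] : AddMonoidHomClass (BimodHom R V M) V M :=
  inferInstanceAs (AddMonoidHomClass (V →ₗ[Rᵐᵒᵖ] M) V M)

/-- The right `S`-action on `Hom_R(V, M)`: `(f s)(v) = f(s v)`. -/
instance rightModule [SMulCommClass S Rᵐᵒᵖ V] (M : Type u) [AddCommGroup M] [Module Rᵐᵒᵖ M] :
    Module Sᵐᵒᵖ (BimodHom R V M) where
  smul s f := LinearMap.comp (f : V →ₗ[Rᵐᵒᵖ] M) (DistribSMul.toLinearMap Rᵐᵒᵖ V s.unop)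
  one_smul f := DFunLike.ext _ _ fun v => congrArg f (one_smul S v)
  mul_smul r s f := DFunLike.ext _ _ fun v => congrArg f (mul_smul s.unop r.unop v)
  smul_zero _ := rfl
  smul_add _ _ _ := rfl
  add_smul r s f := DFunLike.ext _ _ fun v =>
    (congrArg f (add_smul r.unop s.unop v)).trans (map_add f _ _)
  zero_smul f := DFunLike.ext _ _ fun v => (congrArg f (zero_smul S v)).trans (map_zero f)

/-- Postcomposition `Hom_R(V, M) → Hom_R(V, N)`, as a map of right `S`-modules. -/
def map [SMulCommClass S Rᵐᵒᵖ V] {M N : Type u} [AddCommGroup M] [Module Rᵐᵒᵖ M]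
    [AddCommGroup N] [Module Rᵐᵒᵖ N] (g : M →ₗ[Rᵐᵒᵖ] N) :
    BimodHom R V M →ₗ[Sᵐᵒᵖ] BimodHom R V N where
  toFun f := LinearMap.comp g (f : V →ₗ[Rᵐᵒᵖ] M)
  map_add' f f' := DFunLike.ext _ _ fun v => map_add g (f v) (f' v)
  map_smul' s f := DFunLike.ext _ _ fun v => (rfl : g (f (s.unop • v)) = g (f (s.unop • v)))

end BimodHom

/-- The relations `(m s) ⊗ v = m ⊗ (s v)`. -/
def balancedRelations (S V M : Type u) [Ring S] [AddCommGroup V] [Module S V]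
    [AddCommGroup M] [Module Sᵐᵒᵖ M] : AddSubgroup (M ⊗[ℤ] V) :=
  AddSubgroup.closure {x | ∃ (m : M) (s : S) (v : V),
    x = (MulOpposite.op s • m) ⊗ₜ[ℤ] v - m ⊗ₜ[ℤ] (s • v)}

/-- The balanced tensor product `M ⊗_S V` of a right `S`-module `M` and a left `S`-module `V`. -/
def BimodTensor (S V M : Type u) [Ring S] [AddCommGroup V] [Module S V]
    [AddCommGroup M] [Module Sᵐᵒᵖ M] : Type u :=
  (M ⊗[ℤ] V) ⧸ balancedRelations S V M

namespace BimodTensor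

section Balanced

variable (S V : Type u) [Ring S] [AddCommGroup V] [Module S V]

instance (M : Type u) [AddCommGroup M] [Module Sᵐᵒᵖ M] : AddCommGroup (BimodTensor S V M) :=
  inferInstanceAs (AddCommGroup ((M ⊗[ℤ] V) ⧸ balancedRelations S V M))

/-- The pure tensor `m ⊗ v` in `M ⊗_S V`. -/
def tmul {M : Type u} [AddCommGroup M] [Module Sᵐᵒᵖ M] (m : M) (v : V) : BimodTensor S V M :=
  QuotientAddGroup.mk' (balancedRelations S V M) (m ⊗ₜ[ℤ] v)

variable {S V} in
@[elab_as_elim]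
theorem induction {M : Type u} [AddCommGroup M] [Module Sᵐᵒᵖ M]
    {p : BimodTensor S V M → Prop} (x : BimodTensor S V M) (zero : p 0)
    (tmul : ∀ m v, p (tmul S V m v)) (add : ∀ x y, p x → p y → p (x + y)) : p x := by
  obtain ⟨y, rfl⟩ := QuotientAddGroup.mk'_surjective (balancedRelations S V M) x
  induction y using TensorProduct.induction_on with
  | zero => rw [map_zero]; exact zero
  | tmul m v => exact tmul m v
  | add a b ha hb => rw [map_add]; exact add _ _ ha hb

/-- The additive map `f ⊗ g : M ⊗_S V → N ⊗_S V` for `S`-linear maps `f` and `g`. -/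
def mapAux {M N : Type u} [AddCommGroup M] [Module Sᵐᵒᵖ M] [AddCommGroup N]
    [Module Sᵐᵒᵖ N] (f : M →ₗ[Sᵐᵒᵖ] N) (g : V →ₗ[S] V) :
    BimodTensor S V M →+ BimodTensor S V N :=
  QuotientAddGroup.map (balancedRelations S V M) (balancedRelations S V N)
    (TensorProduct.map f.toAddMonoidHom.toIntLinearMap
      g.toAddMonoidHom.toIntLinearMap).toAddMonoidHom
    (by
      rw [balancedRelations, AddSubgroup.closure_le]
      rintro _ ⟨m, s, v, rfl⟩
      refine AddSubgroup.subset_closure ⟨f m, s, g v, ?_⟩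
      refine (map_sub (TensorProduct.map f.toAddMonoidHom.toIntLinearMap
        g.toAddMonoidHom.toIntLinearMap).toAddMonoidHom _ _).trans ?_
      exact congrArg₂ (fun (a : N) (b : V) => a ⊗ₜ[ℤ] g v - f m ⊗ₜ[ℤ] b)
        (f.map_smul _ _) (g.map_smul _ _))

theorem mapAux_tmul {M N : Type u} [AddCommGroup M] [Module Sᵐᵒᵖ M] [AddCommGroup N]
    [Module Sᵐᵒᵖ N] (f : M →ₗ[Sᵐᵒᵖ] N) (g : V →ₗ[S] V) (m : M) (v : V) :
    mapAux S V f g (tmul S V m v) = tmul S V (f m) (g v) := rfl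

theorem tmul_add {M : Type u} [AddCommGroup M] [Module Sᵐᵒᵖ M] (m : M) (v w : V) :
    tmul S V m (v + w) = tmul S V m v + tmul S V m w := by
  simp only [tmul, TensorProduct.tmul_add]
  exact map_add (QuotientAddGroup.mk' (balancedRelations S V M)) _ _

theorem tmul_zero {M : Type u} [AddCommGroup M] [Module Sᵐᵒᵖ M] (m : M) :
    tmul S V m 0 = 0 := by
  simp only [tmul, TensorProduct.tmul_zero]
  exact map_zero (QuotientAddGroup.mk' (balancedRelations S V M))

end Balanced

section Action

variable (S R V : Type u) [Ring S] [Ring R] [AddCommGroup V] [Module S V] [Module Rᵐᵒᵖ V]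
  [SMulCommClass S Rᵐᵒᵖ V]

/-- Right multiplication by `r` on an `S`-`R`-bimodule, as a map of left `S`-modules. -/
def rightMul (r : Rᵐᵒᵖ) : V →ₗ[S] V where
  toFun v := r • v
  map_add' := smul_add r
  map_smul' s v := (smul_comm s r v).symm

/-- The right `R`-action on `M ⊗_S V`: `(m ⊗ v) r = m ⊗ (v r)`. -/
instance rightModule (M : Type u) [AddCommGroup M] [Module Sᵐᵒᵖ M] :
    Module Rᵐᵒᵖ (BimodTensor S V M) where
  smul r x := mapAux S V LinearMap.id (rightMul S R V r) x
  one_smul x := by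
    change mapAux S V LinearMap.id (rightMul S R V 1) x = x
    induction x using BimodTensor.induction with
    | zero => exact map_zero _
    | tmul m v => exact congrArg (tmul S V m) (one_smul Rᵐᵒᵖ v)
    | add a b ha hb => rw [map_add, ha, hb]
  mul_smul r s x := by
    change mapAux S V LinearMap.id (rightMul S R V (r * s)) x =
      mapAux S V LinearMap.id (rightMul S R V r) (mapAux S V LinearMap.id (rightMul S R V s) x)
    induction x using BimodTensor.induction with
    | zero => simp only [map_zero]
    | tmul m v => exact congrArg (tmul S V m) (mul_smul r s v)
    | add a b ha hb => simp only [map_add, ha, hb]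
  smul_zero r := map_zero (mapAux S V LinearMap.id (rightMul S R V r))
  smul_add r := map_add (mapAux S V LinearMap.id (rightMul S R V r))
  add_smul r s x := by
    change mapAux S V LinearMap.id (rightMul S R V (r + s)) x =
      mapAux S V LinearMap.id (rightMul S R V r) x + mapAux S V LinearMap.id (rightMul S R V s) x
    induction x using BimodTensor.induction with
    | zero => simp only [map_zero, add_zero]
    | tmul m v => exact (congrArg (tmul S V m) (add_smul r s v)).trans (tmul_add S V m _ _)
    | add a b ha hb => simp only [map_add, ha, hb]; abel
  zero_smul x := by
    change mapAux S V LinearMap.id (rightMul S R V 0) x = 0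
    induction x using BimodTensor.induction with
    | zero => exact map_zero _
    | tmul m v => exact (congrArg (tmul S V m) (zero_smul Rᵐᵒᵖ v)).trans (tmul_zero S V m)
    | add a b ha hb => rw [map_add, ha, hb, add_zero]

/-- The map `f ⊗ V : M ⊗_S V → N ⊗_S V`, as a map of right `R`-modules. -/
def map {M N : Type u} [AddCommGroup M] [Module Sᵐᵒᵖ M] [AddCommGroup N]
    [Module Sᵐᵒᵖ N] (f : M →ₗ[Sᵐᵒᵖ] N) : BimodTensor S V M →ₗ[Rᵐᵒᵖ] BimodTensor S V N where
  toFun := mapAux S V f LinearMap.id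
  map_add' := map_add _
  map_smul' r x := by
    change mapAux S V f LinearMap.id (mapAux S V LinearMap.id (rightMul S R V r) x) =
      mapAux S V LinearMap.id (rightMul S R V r) (mapAux S V f LinearMap.id x)
    induction x using BimodTensor.induction with
    | zero => simp only [map_zero]
    | tmul m v => rfl
    | add a b ha hb => simp only [map_add, ha, hb]

end Action

end BimodTensor

section Functors

variable (S R V : Type u) [Ring S] [Ring R] [AddCommGroup V] [Module S V] [Module Rᵐᵒᵖ V]
  [SMulCommClass S Rᵐᵒᵖ V]

/-- The functor `Hom_R(V, -)` from right `R`-modules to right `S`-modules. -/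
def homFunctor : ModuleCat.{u} Rᵐᵒᵖ ⥤ ModuleCat.{u} Sᵐᵒᵖ where
  obj M := ModuleCat.of Sᵐᵒᵖ (BimodHom R V M)
  map g := ModuleCat.ofHom (BimodHom.map S R V g.hom)
  map_id _ := rfl
  map_comp _ _ := rfl

/-- The functor `- ⊗_S V` from right `S`-modules to right `R`-modules. -/
def tensorFunctor : ModuleCat.{u} Sᵐᵒᵖ ⥤ ModuleCat.{u} Rᵐᵒᵖ where
  obj M := ModuleCat.of Rᵐᵒᵖ (BimodTensor S V M)
  map f := ModuleCat.ofHom (BimodTensor.map S R V f.hom)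
  map_id M := by
    refine ModuleCat.hom_ext (LinearMap.ext fun x => ?_)
    change BimodTensor.mapAux S V LinearMap.id LinearMap.id x = x
    induction x using BimodTensor.induction with
    | zero => exact map_zero _
    | tmul m v => rfl
    | add a b ha hb => rw [map_add, ha, hb]
  map_comp {M N L} f g := by
    refine ModuleCat.hom_ext (LinearMap.ext fun x => ?_)
    change BimodTensor.mapAux S V (g.hom.comp f.hom) LinearMap.id x =
      BimodTensor.mapAux S V g.hom LinearMap.id (BimodTensor.mapAux S V f.hom LinearMap.id x)
    induction x using BimodTensor.induction with
    | zero => simp only [map_zero]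
    | tmul m v => rfl
    | add a b ha hb => simp only [map_add, ha, hb]

end Functors

/-! ### Subcategories of `mod A`

A full subcategory of the category `mod A` of finitely generated `A`-modules is given by a property
of objects of `ModuleCat A` that implies finite generation. -/

section Subcategories

variable {A : Type u} [Ring A]

/-- `0 → X → Y → Z → 0` is a short exact sequence. -/
def IsShortExact {X Y Z : ModuleCat.{u} A} (f : X ⟶ Y) (g : Y ⟶ Z) : Prop :=
  ∃ w : f ≫ g = 0, (ShortComplex.mk f g w).ShortExact

/-- `Ext_A^n(X, Y) = 0`. -/
def ExtVanishes (X Y : ModuleCat.{u} A) (n : ℕ) : Prop :=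
  Subsingleton (Ext X Y n)

/-- `add T`: direct summands of finite direct sums of copies of `T`. -/
def addClosure (T : ModuleCat.{u} A) : ObjectProperty (ModuleCat.{u} A) := fun M =>
  ∃ n : ℕ, Nonempty (Retract M (ModuleCat.of A (Fin n → T)))

/-- A resolving subcategory of `mod A`: it contains the finitely generated projective modules and
is closed under extensions, kernels of epimorphisms and direct summands. -/
structure IsResolving (P : ObjectProperty (ModuleCat.{u} A)) : Prop where
  le_fg : P ≤ ModuleCat.isFG A
  projective : ∀ M : ModuleCat.{u} A, ModuleCat.isFG A M → Projective M → P M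
  extension : ∀ {X Y Z : ModuleCat.{u} A} (f : X ⟶ Y) (g : Y ⟶ Z), IsShortExact f g →
    P X → P Z → P Y
  kernel : ∀ {X Y Z : ModuleCat.{u} A} (f : X ⟶ Y) (g : Y ⟶ Z), ModuleCat.isFG A X →
    IsShortExact f g → P Y → P Z → P X
  summand : ∀ {X Y : ModuleCat.{u} A}, Retract X Y → P Y → P X

/-- A coresolving subcategory of `mod A`: it contains the finitely generated injective modules and
is closed under extensions, cokernels of monomorphisms and direct summands. -/
structure IsCoresolving (P : ObjectProperty (ModuleCat.{u} A)) : Prop where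
  le_fg : P ≤ ModuleCat.isFG A
  injective : ∀ M : ModuleCat.{u} A, ModuleCat.isFG A M → Injective M → P M
  extension : ∀ {X Y Z : ModuleCat.{u} A} (f : X ⟶ Y) (g : Y ⟶ Z), IsShortExact f g →
    P X → P Z → P Y
  cokernel : ∀ {X Y Z : ModuleCat.{u} A} (f : X ⟶ Y) (g : Y ⟶ Z), IsShortExact f g →
    P X → P Y → P Z
  summand : ∀ {X Y : ModuleCat.{u} A}, Retract X Y → P Y → P X

/-- Covariantly finite: every finitely generated module `X` has a left `P`-approximation. -/
def IsCovariantlyFinite (P : ObjectProperty (ModuleCat.{u} A)) : Prop :=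
  ∀ X : ModuleCat.{u} A, ModuleCat.isFG A X → ∃ (Y : ModuleCat.{u} A) (f : X ⟶ Y), P Y ∧
    ∀ (Z : ModuleCat.{u} A) (g : X ⟶ Z), P Z → ∃ h : Y ⟶ Z, f ≫ h = g

/-- Contravariantly finite: every finitely generated module `X` has a right `P`-approximation. -/
def IsContravariantlyFinite (P : ObjectProperty (ModuleCat.{u} A)) : Prop :=
  ∀ X : ModuleCat.{u} A, ModuleCat.isFG A X → ∃ (Y : ModuleCat.{u} A) (f : Y ⟶ X), P Y ∧
    ∀ (Z : ModuleCat.{u} A) (g : Z ⟶ X), P Z → ∃ h : Z ⟶ Y, h ≫ f = g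

/-- `T` is an Ext-projective generator of `P`. -/
structure IsExtProjectiveGenerator (P : ObjectProperty (ModuleCat.{u} A)) (T : ModuleCat.{u} A) :
    Prop where
  mem : P T
  ext_vanishes : ∀ X : ModuleCat.{u} A, P X → ExtVanishes T X 1
  generates : ∀ X : ModuleCat.{u} A, P X → ∃ (X' T' : ModuleCat.{u} A) (f : X' ⟶ T') (g : T' ⟶ X),
    P X' ∧ addClosure T T' ∧ IsShortExact f g

/-- `(B, P)` is a cotorsion pair in `mod A`: `B = Ker Ext¹(-, P)` and `P = Ker Ext¹(B, -)`. -/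
structure IsCotorsionPair (B P : ObjectProperty (ModuleCat.{u} A)) : Prop where
  left_iff : ∀ X : ModuleCat.{u} A, B X ↔
    ModuleCat.isFG A X ∧ ∀ Y : ModuleCat.{u} A, P Y → ExtVanishes X Y 1
  right_iff : ∀ Y : ModuleCat.{u} A, P Y ↔
    ModuleCat.isFG A Y ∧ ∀ X : ModuleCat.{u} A, B X → ExtVanishes X Y 1

/-- A complete hereditary cotorsion pair in `mod A`. -/
structure IsCompleteHereditaryCotorsionPair (B P : ObjectProperty (ModuleCat.{u} A)) : Prop where
  cotorsionPair : IsCotorsionPair B P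
  hereditary : IsResolving B
  complete_right : ∀ X : ModuleCat.{u} A, ModuleCat.isFG A X →
    ∃ (Y Z : ModuleCat.{u} A) (f : X ⟶ Y) (g : Y ⟶ Z), P Y ∧ B Z ∧ IsShortExact f g
  complete_left : ∀ X : ModuleCat.{u} A, ModuleCat.isFG A X →
    ∃ (Y Z : ModuleCat.{u} A) (f : Y ⟶ Z) (g : Z ⟶ X), P Y ∧ B Z ∧ IsShortExact f g

end Subcategories

/-! ### Equivalences between subcategories -/

/-- The functor `H` restricts to an equivalence from the full subcategory `P` to the full
subcategory `Q`. -/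
def InducesEquivalence {C D : Type*} [Category* C] [Category* D] (H : C ⥤ D)
    (P : ObjectProperty C) (Q : ObjectProperty D) : Prop :=
  ∃ e : P.FullSubcategory ≌ Q.FullSubcategory, Nonempty (e.functor ⋙ Q.ι ≅ P.ι ⋙ H)

/-- The functors `H` and `K` restrict to mutually quasi-inverse equivalences between the full
subcategories `P` and `Q`. -/
def InduceInverseEquivalences {C D : Type*} [Category* C] [Category* D] (H : C ⥤ D) (K : D ⥤ C)
    (P : ObjectProperty C) (Q : ObjectProperty D) : Prop :=
  ∃ e : P.FullSubcategory ≌ Q.FullSubcategory,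
    Nonempty (e.functor ⋙ Q.ι ≅ P.ι ⋙ H) ∧ Nonempty (e.inverse ⋙ P.ι ≅ Q.ι ⋙ K)

/-- The bimodules `_S V_R` and `_R W_S` represent a cotorsion pair counter equivalence between
`(B, P)` (right `R`-modules) and `(G, K)` (right `S`-modules). -/
def RepresentsCounterEquivalence (S R V W : Type u) [Ring S] [Ring R]
    [AddCommGroup V] [Module S V] [Module Rᵐᵒᵖ V] [SMulCommClass S Rᵐᵒᵖ V]
    [AddCommGroup W] [Module R W] [Module Sᵐᵒᵖ W] [SMulCommClass R Sᵐᵒᵖ W]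
    (B P : ObjectProperty (ModuleCat.{u} Rᵐᵒᵖ)) (G K : ObjectProperty (ModuleCat.{u} Sᵐᵒᵖ)) :
    Prop :=
  InduceInverseEquivalences (homFunctor S R V) (tensorFunctor S R V) P G ∧
    InduceInverseEquivalences (homFunctor R S W) (tensorFunctor R S W) K B

/-! ### Wakamatsu-tilting modules -/

/-- The endomorphism ring `S = End(T_R)` of a right `R`-module, acting on `T` from the left. -/
abbrev RightEnd (R T : Type u) [Ring R] [AddCommGroup T] [Module Rᵐᵒᵖ T] : Type u :=
  Module.End Rᵐᵒᵖ T

/-- A Wakamatsu-tilting right `R`-module `T`: finitely generated, with `R = End(_S T)` canonically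
for `S = End(T_R)`, and without self-extensions over `R` and over `S`. -/
structure IsWakamatsuTilting (R T : Type u) [Ring R] [AddCommGroup T] [Module Rᵐᵒᵖ T] : Prop where
  finite : Module.Finite Rᵐᵒᵖ T
  doubleCentralizer : Function.Bijective (Module.toModuleEnd (RightEnd R T) (S := Rᵐᵒᵖ) T)
  ext_right : ∀ i : ℕ, 0 < i →
    ExtVanishes (ModuleCat.of Rᵐᵒᵖ T) (ModuleCat.of Rᵐᵒᵖ T) i
  ext_left : ∀ i : ℕ, 0 < i →
    ExtVanishes (ModuleCat.of (RightEnd R T) T) (ModuleCat.of (RightEnd R T) T) i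

/-- A good Wakamatsu-tilting right module `T` over an artin `k`-algebra `R`: with `S = End(T_R)`,
the bimodules `_S T_R` and `_R DT_S` represent a cotorsion pair counter equivalence between complete
hereditary cotorsion pairs in `mod R` and `mod S`. -/
def IsGoodWakamatsuTilting (k R T : Type u) [CommRing k] [Ring R] [Algebra k R] [AddCommGroup T]
    [Module Rᵐᵒᵖ T] [Module k T] [IsScalarTower k Rᵐᵒᵖ T] : Prop :=
  IsWakamatsuTilting R T ∧
    haveI : SMulCommClass Rᵐᵒᵖ k T := IsScalarTower.to_smulCommClass'
    ∃ (B P : ObjectProperty (ModuleCat.{u} Rᵐᵒᵖ))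
      (G K : ObjectProperty (ModuleCat.{u} (RightEnd R T)ᵐᵒᵖ)),
      IsCompleteHereditaryCotorsionPair B P ∧ IsCompleteHereditaryCotorsionPair G K ∧
        RepresentsCounterEquivalence (RightEnd R T) R T (ArtinDual k T) B P G K

end

noncomputable section

/-! ### Vanishing of `Ext` and lifting along short exact sequences -/

section ExtVanishing

variable {A : Type u} [Ring A] {X Y K M N : ModuleCat.{u} A}

/-! Write D for the duality, `P` for the class in mod R, B for its left perpendicular class and K
for the right perpendicular class of `G`. Wakamatsu's lemma turns the approximations of `P` and `G`
into special ones, and a pushout or pullback supplies the missing half; so (B, `P`) and (`G`, K) are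
complete hereditary cotorsion pairs.

The first equivalence is formal. A module in `P` has a presentation by powers of T with kernels in
`P`, along which Hom(T, -) is exact; since S = End(T), the counit is an isomorphism
(`bijective_counit`). Modules in `G` have the form Hom(T, X), so the triangle identity handles the
unit.

The second equivalence repeats this for DT and K. As DR is injective, DT = Hom(T, DR) lies in `G`.
If N = Hom(T, X) lies in both `G` and K, embedding X in a power of DR and applying Hom(T, -) gives a
sequence that splits, so N is in add DT. Hence special `G`-precovers present the modules of K by
powers of DT. Matlis duality and the double centralizer property give End(DT_S) = R, so the counit
is an isomorphism on K.

All remaining orthogonality comes from `IsPowGenerated.extVanishes_hom`: Ext¹_S(Hom_R(V, Y), D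
Hom_R(N, V)) = 0 if V generates a class containing Y and Ext¹_R(N, -) vanishes on that class. The
reason is that S-maps from Hom(V, Y) to D Hom(N, V) are functionals on Hom(N, Y), and functionals
extend along injections. It is applied to DT = D Hom_R(R, T), to X ⊗ DT = D Hom_R(X, T) for X in B,
and, with DT in place of T, to A = D Hom_S(Hom_R(T, A), DT) for A in `P`. The same correspondence
with Y = DR shows that the unit is onto for X in B; it is injective because such X embed in powers
of T (`bijective_unit_artinDual`). -/

theorem ExtVanishes.lift (h : ExtVanishes X K 1) {f : K ⟶ M} {g : M ⟶ N} (hs : IsShortExact f g)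
    (φ : X ⟶ N) : ∃ ψ : X ⟶ M, ψ ≫ g = φ := by
  obtain ⟨w, hs⟩ := hs
  have := h
  obtain ⟨x, hx⟩ := Ext.covariant_sequence_exact₃ X hs (Ext.mk₀ φ) (zero_add 1)
    (@Subsingleton.elim _ h _ _)
  obtain ⟨ψ, rfl⟩ := (Ext.mk₀_bijective X M).2 x
  refine ⟨ψ, (Ext.mk₀_bijective X N).1 ?_⟩
  rw [← hx, Ext.mk₀_comp_mk₀]

theorem ExtVanishes.extend (h : ExtVanishes X Y 1) {f : K ⟶ M} {g : M ⟶ X} (hs : IsShortExact f g)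
    (φ : K ⟶ Y) : ∃ ψ : M ⟶ Y, f ≫ ψ = φ := by
  obtain ⟨w, hs⟩ := hs
  obtain ⟨x, hx⟩ := Ext.contravariant_sequence_exact₁ hs Y (Ext.mk₀ φ) (add_zero 1)
    (@Subsingleton.elim _ h _ _)
  obtain ⟨ψ, rfl⟩ := (Ext.mk₀_bijective M Y).2 x
  refine ⟨ψ, (Ext.mk₀_bijective K Y).1 ?_⟩
  rw [← hx, Ext.mk₀_comp_mk₀]

/-- Since Ext¹(M, Y) = 0, every class in Ext¹(X, Y) is the pushout of the sequence along some map K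
→ Y; a map that extends to M gives a split pushout. Applied with M projective. -/
theorem extVanishes_of_forall_extend {f : K ⟶ M} {g : M ⟶ X} (hs : IsShortExact f g)
    (hM : ExtVanishes M Y 1) (H : ∀ φ : K ⟶ Y, ∃ ψ : M ⟶ Y, f ≫ ψ = φ) : ExtVanishes X Y 1 := by
  obtain ⟨w, hs⟩ := hs
  refine subsingleton_of_forall_eq 0 fun x => ?_
  obtain ⟨y, rfl⟩ := Ext.contravariant_sequence_exact₃ hs Y x (@Subsingleton.elim _ hM _ _)
    (add_zero 1)
  obtain ⟨φ, rfl⟩ := (Ext.mk₀_bijective K Y).2 y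
  obtain ⟨ψ, rfl⟩ := H φ
  rw [← Ext.mk₀_comp_mk₀, ← Ext.comp_assoc_of_second_deg_zero]
  have : hs.extClass.comp (Ext.mk₀ f) (add_zero 1) = 0 := hs.extClass_comp
  rw [this, Ext.zero_comp]

theorem extVanishes_of_forall_lift {f : Y ⟶ M} {g : M ⟶ N} (hs : IsShortExact f g)
    (hM : ExtVanishes X M 1) (H : ∀ φ : X ⟶ N, ∃ ψ : X ⟶ M, ψ ≫ g = φ) : ExtVanishes X Y 1 := by
  obtain ⟨w, hs⟩ := hs
  refine subsingleton_of_forall_eq 0 fun x => ?_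
  obtain ⟨y, rfl⟩ := Ext.covariant_sequence_exact₁ X hs x (@Subsingleton.elim _ hM _ _)
    (zero_add 1)
  obtain ⟨φ, rfl⟩ := (Ext.mk₀_bijective X N).2 y
  obtain ⟨ψ, rfl⟩ := H φ
  rw [← Ext.mk₀_comp_mk₀, Ext.comp_assoc_of_second_deg_zero]
  have : (Ext.mk₀ g).comp hs.extClass (zero_add 1) = 0 := hs.comp_extClass
  rw [this, Ext.comp_zero]

theorem ExtVanishes.middle_right {n : ℕ} {f : K ⟶ M} {g : M ⟶ N} (hs : IsShortExact f g)
    (hK : ExtVanishes X K n) (hN : ExtVanishes X N n) : ExtVanishes X M n := by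
  obtain ⟨w, hs⟩ := hs
  refine subsingleton_of_forall_eq 0 fun x => ?_
  obtain ⟨y, rfl⟩ := Ext.covariant_sequence_exact₂ X hs x (@Subsingleton.elim _ hN _ _)
  rw [@Subsingleton.elim _ hK y 0, Ext.zero_comp]

theorem ExtVanishes.middle_left {n : ℕ} {f : K ⟶ M} {g : M ⟶ N} (hs : IsShortExact f g)
    (hK : ExtVanishes K Y n) (hN : ExtVanishes N Y n) : ExtVanishes M Y n := by
  obtain ⟨w, hs⟩ := hs
  refine subsingleton_of_forall_eq 0 fun x => ?_
  obtain ⟨y, rfl⟩ := Ext.contravariant_sequence_exact₂ hs Y x (@Subsingleton.elim _ hK _ _)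
  rw [@Subsingleton.elim _ hN y 0, Ext.comp_zero]

/-- Dimension shifting in the second variable. -/
theorem ExtVanishes.succ_of_cokernel {n : ℕ} {f : K ⟶ M} {g : M ⟶ N} (hs : IsShortExact f g)
    (hN : ExtVanishes X N n) (hM : ExtVanishes X M (n + 1)) : ExtVanishes X K (n + 1) := by
  obtain ⟨w, hs⟩ := hs
  refine subsingleton_of_forall_eq 0 fun x => ?_
  obtain ⟨y, rfl⟩ := Ext.covariant_sequence_exact₁ X hs x (@Subsingleton.elim _ hM _ _) rfl
  rw [@Subsingleton.elim _ hN y 0, Ext.zero_comp]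

/-- Together with `ExtVanishes.succ_of_cokernel` this shifts Ext¹ out of a kernel to Ext² and back
to Ext¹ into a cosyzygy, which is how a cotorsion pair with coresolving right class is seen to be
hereditary. -/
theorem ExtVanishes.of_kernel {n : ℕ} {f : K ⟶ M} {g : M ⟶ N} (hs : IsShortExact f g)
    (hN : ExtVanishes N Y (1 + n)) (hM : ExtVanishes M Y n) : ExtVanishes K Y n := by
  obtain ⟨w, hs⟩ := hs
  refine subsingleton_of_forall_eq 0 fun x => ?_
  obtain ⟨y, rfl⟩ := Ext.contravariant_sequence_exact₁ hs Y x rfl (@Subsingleton.elim _ hN _ _)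
  rw [@Subsingleton.elim _ hM y 0, Ext.comp_zero]

theorem ExtVanishes.retract_left {n : ℕ} (r : Retract X M) (h : ExtVanishes M Y n) :
    ExtVanishes X Y n := by
  refine subsingleton_of_forall_eq 0 fun x => ?_
  rw [← Ext.mk₀_id_comp x, ← r.retract, ← Ext.mk₀_comp_mk₀,
    Ext.comp_assoc (α := Ext.mk₀ r.i) (β := Ext.mk₀ r.r) (γ := x) _ (zero_add n) (by omega),
    @Subsingleton.elim _ h ((Ext.mk₀ r.r).comp x (zero_add n)) 0, Ext.comp_zero]

theorem ExtVanishes.retract_right {n : ℕ} (r : Retract Y M) (h : ExtVanishes X M n) :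
    ExtVanishes X Y n := by
  refine subsingleton_of_forall_eq 0 fun x => ?_
  rw [← Ext.comp_mk₀_id x, ← r.retract, ← Ext.mk₀_comp_mk₀,
    ← Ext.comp_assoc (α := x) (β := Ext.mk₀ r.i) (γ := Ext.mk₀ r.r) (add_zero n) _ (by omega),
    @Subsingleton.elim _ h (x.comp (Ext.mk₀ r.i) (add_zero n)) 0, Ext.zero_comp]

theorem extVanishes_of_projective (hX : Projective X) : ExtVanishes X Y 1 :=
  Ext.subsingleton_of_projective X Y 0

theorem extVanishes_of_injective (hY : Injective Y) (n : ℕ) : ExtVanishes X Y (n + 1) :=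
  Ext.subsingleton_of_injective X Y n

end ExtVanishing

/-! ### Short exact sequences of modules -/

section ShortExact

variable {A : Type u} [Ring A]

theorem isShortExact_iff {X Y Z : ModuleCat.{u} A} (f : X ⟶ Y) (g : Y ⟶ Z) :
    IsShortExact f g ↔ Function.Injective f.hom ∧ Function.Exact f.hom g.hom ∧
      Function.Surjective g.hom := by
  constructor
  · rintro ⟨w, h⟩
    exact ⟨h.moduleCat_injective_f,
      (ShortComplex.ShortExact.moduleCat_exact_iff_function_exact _).1 h.exact,
      h.moduleCat_surjective_g⟩
  · rintro ⟨h1, h2, h3⟩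
    refine ⟨ModuleCat.hom_ext (LinearMap.ext fun x => h2.apply_apply_eq_zero x), ?_⟩
    exact ModuleCat.shortComplex_shortExact _ h2 h1 h3

theorem isShortExact_ofHom {X Y Z : Type u} [AddCommGroup X] [Module A X] [AddCommGroup Y]
    [Module A Y] [AddCommGroup Z] [Module A Z] {f : X →ₗ[A] Y} {g : Y →ₗ[A] Z}
    (h1 : Function.Injective f) (h2 : Function.Exact f g) (h3 : Function.Surjective g) :
    IsShortExact (ModuleCat.ofHom f) (ModuleCat.ofHom g) :=
  (isShortExact_iff _ _).2 ⟨h1, h2, h3⟩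

theorem isShortExact_ker {Y Z : Type u} [AddCommGroup Y] [Module A Y] [AddCommGroup Z] [Module A Z]
    {g : Y →ₗ[A] Z} (hg : Function.Surjective g) :
    IsShortExact (ModuleCat.ofHom (LinearMap.ker g).subtype) (ModuleCat.ofHom g) :=
  isShortExact_ofHom (Submodule.subtype_injective _)
    (LinearMap.exact_subtype_ker_map g) hg

theorem isShortExact_range {X Y : Type u} [AddCommGroup X] [Module A X] [AddCommGroup Y]
    [Module A Y] {f : X →ₗ[A] Y} (hf : Function.Injective f) :
    IsShortExact (ModuleCat.ofHom f) (ModuleCat.ofHom (LinearMap.range f).mkQ) :=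
  isShortExact_ofHom hf (LinearMap.exact_map_mkQ_range f) (Submodule.mkQ_surjective _)

theorem isShortExact_prod (X Y : Type u) [AddCommGroup X] [Module A X] [AddCommGroup Y]
    [Module A Y] : IsShortExact (ModuleCat.ofHom (LinearMap.inl A X Y))
      (ModuleCat.ofHom (LinearMap.snd A X Y)) :=
  isShortExact_ofHom LinearMap.inl_injective Function.Exact.inl_snd LinearMap.snd_surjective

/-- A retract of modules given by linear maps. -/
def retractOfLinear {X Y : Type u} [AddCommGroup X] [Module A X] [AddCommGroup Y] [Module A Y]
    (i : X →ₗ[A] Y) (r : Y →ₗ[A] X) (h : ∀ x, r (i x) = x) :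
    Retract (ModuleCat.of A X) (ModuleCat.of A Y) where
  i := ModuleCat.ofHom i
  r := ModuleCat.ofHom r
  retract := ModuleCat.hom_ext (LinearMap.ext h)

/-- An isomorphism exhibits a retract. -/
def retractOfEquiv {X Y : Type u} [AddCommGroup X] [Module A X] [AddCommGroup Y] [Module A Y]
    (e : X ≃ₗ[A] Y) : Retract (ModuleCat.of A X) (ModuleCat.of A Y) :=
  retractOfLinear e.toLinearMap e.symm.toLinearMap e.symm_apply_apply

theorem Module.Finite.of_isShortExact {X Y Z : ModuleCat.{u} A} {f : X ⟶ Y} {g : Y ⟶ Z}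
    (hs : IsShortExact f g) (hX : ModuleCat.isFG A X) (hZ : ModuleCat.isFG A Z) :
    ModuleCat.isFG A Y := by
  rw [ModuleCat.isFG_iff] at *
  obtain ⟨-, h2, h3⟩ := (isShortExact_iff _ _).1 hs
  constructor
  refine Submodule.fg_of_fg_map_of_fg_inf_ker g.hom ?_ ?_
  · rw [Submodule.map_top, LinearMap.range_eq_top.2 h3]; exact hZ.1
  · rw [top_inf_eq, h2.linearMap_ker_eq, ← Submodule.map_top]; exact hX.1.map _

theorem Module.Finite.of_isShortExact_right {X Y Z : ModuleCat.{u} A} {f : X ⟶ Y} {g : Y ⟶ Z}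
    (hs : IsShortExact f g) (hY : ModuleCat.isFG A Y) : ModuleCat.isFG A Z := by
  rw [ModuleCat.isFG_iff] at *
  exact Module.Finite.of_surjective g.hom ((isShortExact_iff _ _).1 hs).2.2

theorem Module.Finite.of_isShortExact_left [IsNoetherianRing A] {X Y Z : ModuleCat.{u} A}
    {f : X ⟶ Y} {g : Y ⟶ Z} (hs : IsShortExact f g) (hY : ModuleCat.isFG A Y) :
    ModuleCat.isFG A X := by
  rw [ModuleCat.isFG_iff] at *
  exact Module.Finite.of_injective f.hom ((isShortExact_iff _ _).1 hs).1

theorem Module.Finite.of_retract {X Y : ModuleCat.{u} A} (r : Retract X Y)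
    (hY : ModuleCat.isFG A Y) : ModuleCat.isFG A X := by
  rw [ModuleCat.isFG_iff] at *
  refine Module.Finite.of_surjective r.r.hom fun x => ⟨r.i.hom x, ?_⟩
  exact congrArg (fun f => f.hom x) r.retract

theorem exists_projective_cover (X : ModuleCat.{u} A) (hX : ModuleCat.isFG A X) :
    ∃ (n : ℕ) (g : (Fin n → A) →ₗ[A] X), Function.Surjective g := by
  rw [ModuleCat.isFG_iff] at hX
  exact Module.Finite.exists_fin' A X

theorem projective_fin_pow (n : ℕ) : Projective (ModuleCat.of A (Fin n → A)) :=
  (IsProjective.iff_projective _).1 inferInstance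

theorem ObjectProperty.pow_of_extension {P : ObjectProperty (ModuleCat.{u} A)}
    (hext : ∀ {X Y Z : ModuleCat.{u} A} (f : X ⟶ Y) (g : Y ⟶ Z), IsShortExact f g →
      P X → P Z → P Y)
    (hret : ∀ {X Y : ModuleCat.{u} A}, Retract X Y → P Y → P X)
    {V : Type u} [AddCommGroup V] [Module A V] (hV : P (ModuleCat.of A V)) (n : ℕ) :
    P (ModuleCat.of A (Fin n → V)) := by
  induction n with
  | zero => exact hret (retractOfLinear 0 0 fun x => Subsingleton.elim _ _) hV
  | succ n ih =>
    exact hret (retractOfEquiv (Fin.consLinearEquiv A fun _ => V).symm)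
      (hext _ _ (isShortExact_prod V (Fin n → V)) hV ih)

end ShortExact

/-! ### Minimal approximations and Wakamatsu's lemma -/

section Approximations

variable {A : Type u} [Ring A]

/-- Fitting's lemma: for large `n` the module is the direct sum of the kernel and the image of `h ^
n`, so an image that is not shorter is everything. The length bound is asked only when this
splitting holds, because only then is the image a summand, hence a competitor in a minimality
argument. -/
theorem bijective_of_length_le {Y : Type u} [AddCommGroup Y] [Module A Y] [IsArtinian A Y]
    [IsNoetherian A Y] (h : Module.End A Y)
    (H : ∀ n : ℕ, IsCompl (LinearMap.ker (h ^ n)) (LinearMap.range (h ^ n)) →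
      Module.length A Y ≤ Module.length A (LinearMap.range (h ^ n))) : Function.Bijective h := by
  obtain ⟨n, hn, hn1⟩ := (h.eventually_isCompl_ker_pow_range_pow.and
    (Filter.eventually_ge_atTop 1)).exists
  obtain ⟨m, rfl⟩ := Nat.exists_eq_add_of_le' hn1
  have htop : LinearMap.range (h ^ (m + 1)) = ⊤ := by
    by_contra hne
    exact absurd (H _ hn) (not_le.2 (Submodule.length_lt hne))
  have hker : LinearMap.ker (h ^ (m + 1)) = ⊥ := by
    have := hn.inf_eq_bot
    rwa [htop, inf_top_eq] at this
  constructor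
  · refine Function.Injective.of_comp (f := (h ^ m : Module.End A Y)) ?_
    rw [← Module.End.coe_mul, ← pow_succ]
    exact LinearMap.ker_eq_bot.1 hker
  · refine Function.Surjective.of_comp (g := (h ^ m : Module.End A Y)) ?_
    rw [← Module.End.coe_mul, ← pow_succ']
    exact LinearMap.range_eq_top.1 htop

/-- The image of a power of an endomorphism is a retract, once it is complementary to the kernel. -/
def retractOfIsCompl {Y : ModuleCat.{u} A} (h : Module.End A Y)
    (hc : IsCompl (LinearMap.ker h) (LinearMap.range h)) :
    Retract (ModuleCat.of A (LinearMap.range h)) Y :=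
  retractOfLinear (LinearMap.range h).subtype
    (Submodule.projectionOnto _ _ hc.symm)
    (fun x => Submodule.projectionOnto_apply_left hc.symm x)

variable [IsArtinianRing A]

/-- Take an approximation whose target has least length. If `f ≫ h = f`, then `f` lands in the image
of every power of `h`, and such an image, when a summand, is again the target of an approximation;
so it cannot be shorter. -/
theorem exists_minimal_left_approximation {P : ObjectProperty (ModuleCat.{u} A)}
    (hfg : P ≤ ModuleCat.isFG A)
    (hret : ∀ {X Y : ModuleCat.{u} A}, Retract X Y → P Y → P X)
    (hP : IsCovariantlyFinite P) (X : ModuleCat.{u} A) (hX : ModuleCat.isFG A X) :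
    ∃ (Y : ModuleCat.{u} A) (f : X ⟶ Y), P Y ∧
      (∀ (Z : ModuleCat.{u} A) (g : X ⟶ Z), P Z → ∃ h : Y ⟶ Z, f ≫ h = g) ∧
      ∀ h : Y ⟶ Y, f ≫ h = f → IsIso h := by
  let s : Set ℕ∞ := {n | ∃ (Y : ModuleCat.{u} A) (f : X ⟶ Y), P Y ∧
      (∀ (Z : ModuleCat.{u} A) (g : X ⟶ Z), P Z → ∃ h : Y ⟶ Z, f ≫ h = g) ∧
      Module.length A Y = n}
  have hs : s.Nonempty := by
    obtain ⟨Y, f, hY, hf⟩ := hP X hX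
    exact ⟨_, Y, f, hY, hf, rfl⟩
  obtain ⟨Y, f, hY, hf, hlen⟩ := csInf_mem hs
  refine ⟨Y, f, hY, hf, fun h hh => ?_⟩
  have : Module.Finite A Y := hfg _ hY
  have hpow : ∀ (n : ℕ) (x : X), (h.hom ^ n : Module.End A Y) (f.hom x) = f.hom x := by
    intro n x
    induction n with
    | zero => rfl
    | succ n ih =>
      rw [pow_succ, Module.End.mul_apply, show h.hom (f.hom x) = f.hom x from
        congrArg (fun k => k.hom x) hh, ih]
  refine (ConcreteCategory.isIso_iff_bijective h).2 (bijective_of_length_le h.hom fun n hn => ?_)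
  rw [hlen]
  refine csInf_le' ⟨ModuleCat.of A (LinearMap.range (h.hom ^ n)),
    ModuleCat.ofHom (f.hom.codRestrict _ fun x => ⟨f.hom x, hpow n x⟩),
    hret (retractOfIsCompl _ hn) hY, fun Z g hZ => ?_, rfl⟩
  obtain ⟨k, rfl⟩ := hf Z g hZ
  exact ⟨ModuleCat.ofHom (Submodule.subtype _) ≫ k, rfl⟩

/-- Dually, a right approximation with source of least length restricts to an approximation on the
image of any power of `h` that is a summand. -/
theorem exists_minimal_right_approximation {P : ObjectProperty (ModuleCat.{u} A)}
    (hfg : P ≤ ModuleCat.isFG A)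
    (hret : ∀ {X Y : ModuleCat.{u} A}, Retract X Y → P Y → P X)
    (hP : IsContravariantlyFinite P) (X : ModuleCat.{u} A) (hX : ModuleCat.isFG A X) :
    ∃ (Y : ModuleCat.{u} A) (f : Y ⟶ X), P Y ∧
      (∀ (Z : ModuleCat.{u} A) (g : Z ⟶ X), P Z → ∃ h : Z ⟶ Y, h ≫ f = g) ∧
      ∀ h : Y ⟶ Y, h ≫ f = f → IsIso h := by
  let s : Set ℕ∞ := {n | ∃ (Y : ModuleCat.{u} A) (f : Y ⟶ X), P Y ∧
      (∀ (Z : ModuleCat.{u} A) (g : Z ⟶ X), P Z → ∃ h : Z ⟶ Y, h ≫ f = g) ∧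
      Module.length A Y = n}
  have hs : s.Nonempty := by
    obtain ⟨Y, f, hY, hf⟩ := hP X hX
    exact ⟨_, Y, f, hY, hf, rfl⟩
  obtain ⟨Y, f, hY, hf, hlen⟩ := csInf_mem hs
  refine ⟨Y, f, hY, hf, fun h hh => ?_⟩
  have : Module.Finite A Y := hfg _ hY
  have hpow : ∀ (n : ℕ) (y : Y), f.hom ((h.hom ^ n : Module.End A Y) y) = f.hom y := by
    intro n y
    induction n generalizing y with
    | zero => rfl
    | succ n ih =>
      rw [pow_succ, Module.End.mul_apply, ih]
      exact congrArg (fun k => k.hom y) hh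
  refine (ConcreteCategory.isIso_iff_bijective h).2 (bijective_of_length_le h.hom fun n hn => ?_)
  rw [hlen]
  refine csInf_le' ⟨ModuleCat.of A (LinearMap.range (h.hom ^ n)),
    ModuleCat.ofHom (Submodule.subtype _) ≫ f,
    hret (retractOfIsCompl _ hn) hY, fun Z g hZ => ?_, rfl⟩
  obtain ⟨k, rfl⟩ := hf Z g hZ
  exact ⟨k ≫ ModuleCat.ofHom (LinearMap.rangeRestrict (h.hom ^ n)),
    ModuleCat.hom_ext (LinearMap.ext fun z => hpow n _)⟩

/-- `A` has enough finitely generated injective modules. -/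
def HasEnoughFGInjectives (A : Type u) [Ring A] : Prop :=
  ∀ X : ModuleCat.{u} A, ModuleCat.isFG A X →
    ∃ (I : ModuleCat.{u} A) (f : X ⟶ I), ModuleCat.isFG A I ∧ Injective I ∧
      Function.Injective f.hom

/-- Wakamatsu's lemma for left approximations. -/
theorem IsCoresolving.exists_special_preenvelope {P : ObjectProperty (ModuleCat.{u} A)}
    (hA : HasEnoughFGInjectives A) (hP : IsCoresolving P) (hPfin : IsCovariantlyFinite P)
    (X : ModuleCat.{u} A) (hX : ModuleCat.isFG A X) :
    ∃ (Y Z : ModuleCat.{u} A) (f : X ⟶ Y) (g : Y ⟶ Z), P Y ∧ IsShortExact f g ∧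
      ∀ W : ModuleCat.{u} A, P W → ExtVanishes Z W 1 := by
  obtain ⟨Y, f, hY, hf, hmin⟩ := exists_minimal_left_approximation hP.le_fg hP.summand hPfin X hX
  -- An embedding of `X` in an injective module of `P` factors through the approximation.
  have hinj : Function.Injective f.hom := by
    obtain ⟨I, i, hIfg, hI, hi⟩ := hA X hX
    obtain ⟨h, rfl⟩ := hf I i (hP.injective I hIfg hI)
    exact Function.Injective.of_comp (f := h.hom) hi
  refine ⟨Y, _, f, ModuleCat.ofHom (LinearMap.range f.hom).mkQ, hY, isShortExact_range hinj,
    fun W hW => ?_⟩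
  obtain ⟨I, i, hIfg, hI, hi⟩ := hA W (hP.le_fg _ hW)
  -- With `I` injective, a class in Ext¹ of the cokernel with values in `W` is represented by a map
  -- `c` to `I/W`, and vanishes if `c` lifts to `I`.
  refine extVanishes_of_forall_lift (isShortExact_range hi) (extVanishes_of_injective hI 0)
    fun c => ?_
  let p := (LinearMap.range f.hom).mkQ
  let q := (LinearMap.range i.hom).mkQ
  have hq0 : ∀ w, q (i.hom w) = 0 := fun w =>
    (LinearMap.exact_map_mkQ_range i.hom).apply_apply_eq_zero w
  have hp0 : ∀ w, p (f.hom w) = 0 := fun w =>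
    (LinearMap.exact_map_mkQ_range f.hom).apply_apply_eq_zero w
  -- the pullback of the extension of `W` along `Y → Z`
  let E : Submodule A (Y × I) := LinearMap.eqLocus
    (c.hom ∘ₗ p ∘ₗ LinearMap.fst A Y I) (q ∘ₗ LinearMap.snd A Y I)
  let a : W →ₗ[A] E := (LinearMap.inr A Y I ∘ₗ i.hom).codRestrict E fun w => by
    change c.hom (p 0) = q (i.hom w)
    rw [map_zero, map_zero, hq0]
  let b : E →ₗ[A] Y := LinearMap.fst A Y I ∘ₗ E.subtype
  have hab : IsShortExact (ModuleCat.ofHom a) (ModuleCat.ofHom b) := by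
    refine isShortExact_ofHom (fun w w' hw => hi ?_) (fun e => ⟨fun he => ?_, ?_⟩) fun y => ?_
    · exact congrArg (fun e : E => e.1.2) hw
    · have h1 : c.hom (p e.1.1) = q e.1.2 := e.2
      have he' : e.1.1 = 0 := he
      rw [he', map_zero, map_zero] at h1
      obtain ⟨w, hw⟩ := (LinearMap.exact_map_mkQ_range i.hom _).1 h1.symm
      exact ⟨w, Subtype.ext (Prod.ext he'.symm hw)⟩
    · rintro ⟨w, rfl⟩; rfl
    · obtain ⟨j, hj⟩ := Submodule.mkQ_surjective _ (c.hom (p y))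
      exact ⟨⟨(y, j), hj.symm⟩, rfl⟩
  have hE : P (ModuleCat.of A E) := hP.extension _ _ hab hW hY
  -- The map `x ↦ (f x, 0)` lifts `f` to the pullback, which is in `P` by extension closure.
  -- Factoring it through `f` gives `h`; by minimality `h` followed by the projection to `Y` is
  -- invertible, so the pulled-back extension splits.
  obtain ⟨h, hh⟩ := hf _ (ModuleCat.ofHom ((LinearMap.inl A Y I ∘ₗ f.hom).codRestrict E fun x => by
    change c.hom (p (f.hom x)) = q 0
    rw [hp0, map_zero, map_zero])) hE
  have hφ : f ≫ (h ≫ ModuleCat.ofHom b) = f := by rw [← Category.assoc, hh]; rfl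
  have hiso := hmin _ hφ
  set φ := h ≫ ModuleCat.ofHom b with hφdef
  -- The `I`-coordinate of the splitting. It vanishes on the image of `f`, hence descends to the
  -- cokernel, where it is the required lift of `c`.
  let l : Y →ₗ[A] I := LinearMap.snd A Y I ∘ₗ E.subtype ∘ₗ h.hom ∘ₗ (inv φ).hom
  have hinv : ∀ x, (inv φ).hom (f.hom x) = f.hom x := fun x => by
    have : f ≫ inv φ = f := by rw [IsIso.comp_inv_eq]; exact hφ.symm
    exact congrArg (fun k => k.hom x) this
  have hl : LinearMap.range f.hom ≤ LinearMap.ker l := by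
    rintro _ ⟨x, rfl⟩
    change (h.hom ((inv φ).hom (f.hom x))).1.2 = 0
    rw [hinv]
    have : h.hom (f.hom x) = _ := congrArg (fun k => k.hom x) hh
    rw [this]; rfl
  refine ⟨ModuleCat.ofHom ((LinearMap.range f.hom).liftQ l hl), ModuleCat.hom_ext ?_⟩
  refine Submodule.linearMap_qext _ (LinearMap.ext fun y => ?_)
  change q (l y) = c.hom (p y)
  have h1 : c.hom (p (h.hom ((inv φ).hom y)).1.1) = q (h.hom ((inv φ).hom y)).1.2 :=
    (h.hom ((inv φ).hom y)).2
  have h2 : (h.hom ((inv φ).hom y)).1.1 = y :=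
    congrArg (fun k => k.hom y) (IsIso.inv_hom_id φ)
  rw [h2] at h1
  exact h1.symm

/-- Wakamatsu's lemma for right approximations. -/
theorem IsResolving.exists_special_precover {P : ObjectProperty (ModuleCat.{u} A)}
    (hP : IsResolving P) (hPfin : IsContravariantlyFinite P)
    (X : ModuleCat.{u} A) (hX : ModuleCat.isFG A X) :
    ∃ (Z Y : ModuleCat.{u} A) (f : Z ⟶ Y) (g : Y ⟶ X), P Y ∧ IsShortExact f g ∧
      ∀ W : ModuleCat.{u} A, P W → ExtVanishes W Z 1 := by
  obtain ⟨Y, f, hY, hf, hmin⟩ := exists_minimal_right_approximation hP.le_fg hP.summand hPfin X hX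
  have hpow : ∀ n, P (ModuleCat.of A (Fin n → A)) := fun n =>
    hP.projective _ (by rw [ModuleCat.isFG_iff]; infer_instance) (projective_fin_pow n)
  have hsurj : Function.Surjective f.hom := by
    obtain ⟨n, g, hg⟩ := exists_projective_cover X hX
    obtain ⟨h, hh⟩ := hf _ (ModuleCat.ofHom g) (hpow n)
    refine Function.Surjective.of_comp (g := h.hom) ?_
    have : (h ≫ f).hom = g := congrArg ModuleCat.Hom.hom hh
    rw [← LinearMap.coe_comp, ← ModuleCat.hom_comp, this]
    exact hg
  refine ⟨_, Y, ModuleCat.ofHom (LinearMap.ker f.hom).subtype, f, hY, isShortExact_ker hsurj,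
    fun W hW => ?_⟩
  obtain ⟨n, g, hg⟩ := exists_projective_cover W (hP.le_fg _ hW)
  refine extVanishes_of_forall_extend (isShortExact_ker hg)
    (extVanishes_of_projective (projective_fin_pow n)) fun c => ?_
  let Q := Fin n → A
  let Ω := LinearMap.ker g
  let d : Ω →ₗ[A] Y := (LinearMap.ker f.hom).subtype ∘ₗ c.hom
  have hd : ∀ w, f.hom (d w) = 0 := fun w => (c.hom w).2
  -- the pushout of the projective presentation of `W` along `Ω → Y`
  let N : Submodule A (Y × Q) := LinearMap.range (d.prod (-Ω.subtype))
  let a : Y →ₗ[A] (Y × Q) ⧸ N := N.mkQ ∘ₗ LinearMap.inl A Y Q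
  have hN : N ≤ LinearMap.ker (g ∘ₗ LinearMap.snd A Y Q) := by
    rintro _ ⟨w, rfl⟩
    change g (-(w : Q)) = 0
    rw [map_neg, show g w = 0 from w.2, neg_zero]
  let b : (Y × Q) ⧸ N →ₗ[A] W := N.liftQ (g ∘ₗ LinearMap.snd A Y Q) hN
  have hab : IsShortExact (ModuleCat.ofHom a) (ModuleCat.ofHom b) := by
    refine isShortExact_ofHom ?_ ?_ fun w => ?_
    · rw [injective_iff_map_eq_zero]
      intro y hy
      obtain ⟨w, hw⟩ := (Submodule.Quotient.mk_eq_zero N).1 hy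
      have h1 : d w = y := congrArg Prod.fst hw
      have h2 : -(w : Q) = 0 := congrArg Prod.snd hw
      have h3 : w = 0 := Subtype.ext (neg_eq_zero.1 h2)
      rw [← h1, h3, map_zero]
    · intro e
      constructor
      · obtain ⟨⟨y, v⟩, rfl⟩ := N.mkQ_surjective e
        intro he
        have hv : g v = 0 := he
        refine ⟨y + d ⟨v, hv⟩, ?_⟩
        refine (Submodule.Quotient.eq N).2 ⟨⟨v, hv⟩, ?_⟩
        refine Prod.ext ?_ ?_
        · change d ⟨v, hv⟩ = y + d ⟨v, hv⟩ - y
          abel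
        · change -v = 0 - v
          abel
      · rintro ⟨y, rfl⟩
        exact map_zero g
    · obtain ⟨v, rfl⟩ := hg w
      exact ⟨N.mkQ (0, v), rfl⟩
  have hE : P (ModuleCat.of A ((Y × Q) ⧸ N)) := hP.extension _ _ hab hY hW
  -- The map equal to `f` on `Y` and zero on `Q` is well defined on the pushout because `d` takes
  -- values in the kernel of `f`. It factors through the approximation, and minimality makes the
  -- resulting endomorphism of `Y` invertible.
  obtain ⟨h, hh⟩ := hf _ (ModuleCat.ofHom (N.liftQ (f.hom ∘ₗ LinearMap.fst A Y Q) (by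
    rintro _ ⟨w, rfl⟩
    exact hd w))) hE
  have hφ : (ModuleCat.ofHom a ≫ h) ≫ f = f := by
    rw [Category.assoc, hh]; rfl
  have hiso := hmin _ hφ
  set φ := ModuleCat.ofHom a ≫ h with hφdef
  have hinv : inv φ ≫ f = f := by rw [IsIso.inv_comp_eq]; exact hφ.symm
  -- The retraction of the pushout onto `Y`, restricted to `Q`. It takes values in the kernel of
  -- `f`, and it restricts to `d` because `(0, w)` and `(d w, 0)` agree in the pushout; this is the
  -- required extension of `c`.
  let l : Q →ₗ[A] Y := (inv φ).hom ∘ₗ h.hom ∘ₗ N.mkQ ∘ₗ LinearMap.inr A Y Q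
  have hl : ∀ v, f.hom (l v) = 0 := fun v => by
    have h1 : f.hom (l v) = f.hom (h.hom (N.mkQ (0, v))) :=
      congrArg (fun k => k.hom (h.hom (N.mkQ (0, v)))) hinv
    rw [h1]
    refine (congrArg (fun k => k.hom (N.mkQ (0, v))) hh).trans ?_
    exact map_zero f.hom
  refine ⟨ModuleCat.ofHom (l.codRestrict _ hl), ModuleCat.hom_ext (LinearMap.ext fun w => ?_)⟩
  refine Subtype.ext ?_
  change l (w : Q) = d w
  have h1 : N.mkQ (0, (w : Q)) = a (d w) := by
    refine (Submodule.Quotient.eq N).2 ⟨-w, ?_⟩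
    refine Prod.ext ?_ ?_
    · change d (-w) = 0 - d w
      rw [map_neg]; abel
    · change -((-w : Ω) : Q) = (w : Q) - 0
      simp
  change (inv φ).hom (h.hom (N.mkQ (0, (w : Q)))) = d w
  rw [h1]
  exact congrArg (fun k => k.hom (d w)) (IsIso.hom_inv_id φ)

end Approximations

/-! ### Complete cotorsion pairs from approximations -/

section Cotorsion

variable {A : Type u} [Ring A]

/-- Salce's trick: when `Q` is projective and `Y → Z` comes from a special preenvelope of the syzygy
of `X`, the second sequence puts the pushout in the left perpendicular class, and the first is then
a special precover of `X`. -/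
theorem exists_pushout {Ω Q X Y Z : ModuleCat.{u} A} {j : Ω ⟶ Q} {p : Q ⟶ X} {a : Ω ⟶ Y}
    {q : Y ⟶ Z} (h1 : IsShortExact j p) (h2 : IsShortExact a q) :
    ∃ (E : ModuleCat.{u} A) (i : Y ⟶ E) (p' : E ⟶ X) (i' : Q ⟶ E) (q' : E ⟶ Z),
      IsShortExact i p' ∧ IsShortExact i' q' := by
  obtain ⟨hj, hjp, hp⟩ := (isShortExact_iff _ _).1 h1
  obtain ⟨ha, haq, hq⟩ := (isShortExact_iff _ _).1 h2
  let N : Submodule A (Y × Q) := LinearMap.range (a.hom.prod (-j.hom))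
  have hN1 : N ≤ LinearMap.ker (p.hom ∘ₗ LinearMap.snd A Y Q) := by
    rintro _ ⟨w, rfl⟩
    change p.hom (-(j.hom w)) = 0
    rw [map_neg, hjp.apply_apply_eq_zero, neg_zero]
  have hN2 : N ≤ LinearMap.ker (q.hom ∘ₗ LinearMap.fst A Y Q) := by
    rintro _ ⟨w, rfl⟩
    exact haq.apply_apply_eq_zero w
  refine ⟨ModuleCat.of A ((Y × Q) ⧸ N), ModuleCat.ofHom (N.mkQ ∘ₗ LinearMap.inl A Y Q),
    ModuleCat.ofHom (N.liftQ _ hN1), ModuleCat.ofHom (N.mkQ ∘ₗ LinearMap.inr A Y Q),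
    ModuleCat.ofHom (N.liftQ _ hN2), isShortExact_ofHom ?_ (fun e => ⟨?_, ?_⟩) fun x => ?_,
    isShortExact_ofHom ?_ (fun e => ⟨?_, ?_⟩) fun z => ?_⟩
  · rw [injective_iff_map_eq_zero]
    intro y hy
    obtain ⟨w, hw⟩ := (Submodule.Quotient.mk_eq_zero N).1 hy
    have hw1 : a.hom w = y := congrArg Prod.fst hw
    have hw2 : -(j.hom w) = 0 := congrArg Prod.snd hw
    rw [neg_eq_zero, map_eq_zero_iff _ hj] at hw2
    rw [← hw1, hw2, map_zero]
  · obtain ⟨⟨y, v⟩, rfl⟩ := N.mkQ_surjective e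
    intro he
    obtain ⟨w, rfl⟩ := (hjp v).1 he
    refine ⟨y + a.hom w, (Submodule.Quotient.eq N).2 ⟨w, Prod.ext ?_ ?_⟩⟩
    · change a.hom w = y + a.hom w - y
      abel
    · change -(j.hom w) = 0 - j.hom w
      abel
  · rintro ⟨y, rfl⟩
    exact map_zero p.hom
  · obtain ⟨v, rfl⟩ := hp x
    exact ⟨N.mkQ (0, v), rfl⟩
  · rw [injective_iff_map_eq_zero]
    intro v hv
    obtain ⟨w, hw⟩ := (Submodule.Quotient.mk_eq_zero N).1 hv
    have hw1 : a.hom w = 0 := congrArg Prod.fst hw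
    have hw2 : -(j.hom w) = v := congrArg Prod.snd hw
    rw [map_eq_zero_iff _ ha] at hw1
    rw [← hw2, hw1, map_zero, neg_zero]
  · obtain ⟨⟨y, v⟩, rfl⟩ := N.mkQ_surjective e
    intro he
    obtain ⟨w, rfl⟩ := (haq y).1 he
    refine ⟨v + j.hom w, (Submodule.Quotient.eq N).2 ⟨-w, Prod.ext ?_ ?_⟩⟩
    · change a.hom (-w) = 0 - a.hom w
      rw [map_neg]; abel
    · change -(j.hom (-w)) = v + j.hom w - v
      rw [map_neg]; abel
  · rintro ⟨v, rfl⟩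
    exact map_zero q.hom
  · obtain ⟨y, rfl⟩ := hq z
    exact ⟨N.mkQ (y, 0), rfl⟩

/-- The dual trick, with `I` injective and `G → C` a special precover of the cosyzygy of `X`. -/
theorem exists_pullback {X I C K G : ModuleCat.{u} A} {f : X ⟶ I} {g : I ⟶ C} {f' : K ⟶ G}
    {g' : G ⟶ C} (h1 : IsShortExact f g) (h2 : IsShortExact f' g') :
    ∃ (E : ModuleCat.{u} A) (i : X ⟶ E) (p : E ⟶ G) (i' : K ⟶ E) (p' : E ⟶ I),
      IsShortExact i p ∧ IsShortExact i' p' := by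
  obtain ⟨hf, hfg, hg⟩ := (isShortExact_iff _ _).1 h1
  obtain ⟨hf', hfg', hg'⟩ := (isShortExact_iff _ _).1 h2
  let E : Submodule A (I × G) := LinearMap.eqLocus
    (g.hom ∘ₗ LinearMap.fst A I G) (g'.hom ∘ₗ LinearMap.snd A I G)
  have hi (x : X) : (f.hom x, (0 : G)) ∈ E := by
    change g.hom (f.hom x) = g'.hom 0
    rw [map_zero, hfg.apply_apply_eq_zero]
  have hi' (x : K) : ((0 : I), f'.hom x) ∈ E := by
    change g.hom 0 = g'.hom (f'.hom x)
    rw [map_zero, hfg'.apply_apply_eq_zero]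
  refine ⟨ModuleCat.of A E,
    ModuleCat.ofHom ((LinearMap.inl A I G ∘ₗ f.hom).codRestrict E hi),
    ModuleCat.ofHom (LinearMap.snd A I G ∘ₗ E.subtype),
    ModuleCat.ofHom ((LinearMap.inr A I G ∘ₗ f'.hom).codRestrict E hi'),
    ModuleCat.ofHom (LinearMap.fst A I G ∘ₗ E.subtype),
    isShortExact_ofHom (fun x x' hx => hf (congrArg (fun e : E => e.1.1) hx))
      (fun e => ⟨fun he => ?_, ?_⟩) fun v => ?_,
    isShortExact_ofHom (fun x x' hx => hf' (congrArg (fun e : E => e.1.2) hx))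
      (fun e => ⟨fun he => ?_, ?_⟩) fun v => ?_⟩
  · have h3 : g.hom e.1.1 = g'.hom e.1.2 := e.2
    have he' : e.1.2 = 0 := he
    rw [he', map_zero] at h3
    obtain ⟨x, hx⟩ := (hfg _).1 h3
    exact ⟨x, Subtype.ext (Prod.ext hx he'.symm)⟩
  · rintro ⟨x, rfl⟩; rfl
  · obtain ⟨y, hy⟩ := hg (g'.hom v)
    exact ⟨⟨(y, v), hy⟩, rfl⟩
  · have h3 : g.hom e.1.1 = g'.hom e.1.2 := e.2
    have he' : e.1.1 = 0 := he
    rw [he', map_zero] at h3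
    obtain ⟨x, hx⟩ := (hfg' _).1 h3.symm
    exact ⟨x, Subtype.ext (Prod.ext he'.symm hx)⟩
  · rintro ⟨x, rfl⟩; rfl
  · obtain ⟨y, hy⟩ := hg' (g.hom v)
    exact ⟨⟨(v, y), hy.symm⟩, rfl⟩

/-- The finitely generated modules `X` with `Ext¹(X, P) = 0`. -/
def leftExtPerp (P : ObjectProperty (ModuleCat.{u} A)) : ObjectProperty (ModuleCat.{u} A) :=
  fun X => ModuleCat.isFG A X ∧ ∀ Y : ModuleCat.{u} A, P Y → ExtVanishes X Y 1

/-- The finitely generated modules `Y` with `Ext¹(P, Y) = 0`. -/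
def rightExtPerp (P : ObjectProperty (ModuleCat.{u} A)) : ObjectProperty (ModuleCat.{u} A) :=
  fun Y => ModuleCat.isFG A Y ∧ ∀ X : ModuleCat.{u} A, P X → ExtVanishes X Y 1

/-- If `Ext¹(Z, X) = 0`, then `0 → X → Y → Z → 0` splits. -/
theorem ExtVanishes.nonempty_retract_left {X Y Z : ModuleCat.{u} A} {f : X ⟶ Y} {g : Y ⟶ Z}
    (h : ExtVanishes Z X 1) (hs : IsShortExact f g) : Nonempty (Retract X Y) := by
  obtain ⟨r, hr⟩ := h.extend hs (𝟙 X)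
  exact ⟨⟨f, r, hr⟩⟩

theorem ExtVanishes.nonempty_retract_right {X Y Z : ModuleCat.{u} A} {f : X ⟶ Y} {g : Y ⟶ Z}
    (h : ExtVanishes Z X 1) (hs : IsShortExact f g) : Nonempty (Retract Z Y) := by
  obtain ⟨r, hr⟩ := h.lift hs (𝟙 Z)
  exact ⟨⟨r, g, hr⟩⟩

/-- A class that is closed under extensions and summands and is generated by `add V` is generated
by the powers of `V`, with kernels in the class. -/
theorem exists_pow_precover {P : ObjectProperty (ModuleCat.{u} A)}
    (hext : ∀ {X Y Z : ModuleCat.{u} A} (f : X ⟶ Y) (g : Y ⟶ Z), IsShortExact f g →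
      P X → P Z → P Y)
    (hret : ∀ {X Y : ModuleCat.{u} A}, Retract X Y → P Y → P X)
    {V : ModuleCat.{u} A} (hV : P V) {K W Y : ModuleCat.{u} A} {f : K ⟶ W} {g : W ⟶ Y}
    (hK : P K) (hW : addClosure V W) (hs : IsShortExact f g) :
    ∃ (n : ℕ) (π : (Fin n → V) →ₗ[A] Y), Function.Surjective π ∧
      P (ModuleCat.of A (LinearMap.ker π)) := by
  obtain ⟨n, ⟨r⟩⟩ := hW
  obtain ⟨hf, hfg, hg⟩ := (isShortExact_iff _ _).1 hs
  have hir : ∀ w, r.r.hom (r.i.hom w) = w := fun w => congrArg (fun k => k.hom w) r.retract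
  refine ⟨n, (r.r ≫ g).hom, ?_, ?_⟩
  · rw [ModuleCat.hom_comp, LinearMap.coe_comp]
    exact hg.comp fun w => ⟨r.i.hom w, hir w⟩
  have hprod : P (ModuleCat.of A (K × (Fin n → V))) :=
    hext _ _ (isShortExact_prod K (Fin n → V)) hK (ObjectProperty.pow_of_extension hext hret hV n)
  let e : K ≃ₗ[A] LinearMap.range f.hom := LinearEquiv.ofInjective f.hom hf
  let L := LinearMap.ker (r.r ≫ g).hom
  let a : L →ₗ[A] LinearMap.range f.hom := (r.r.hom ∘ₗ L.subtype).codRestrict _ fun v =>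
    (hfg _).1 v.2
  let b : (Fin n → V) →ₗ[A] (Fin n → V) := LinearMap.id - r.i.hom ∘ₗ r.r.hom
  have hfe : ∀ y : LinearMap.range f.hom, f.hom (e.symm y) = y := fun y =>
    congrArg Subtype.val (e.apply_symm_apply y)
  -- The kernel of the composite `Vⁿ → W → Y` is the direct sum of `K` and the complement of `W` in
  -- `Vⁿ`, onto which `b` projects; so it is a retract of `K × Vⁿ`.
  refine hret (retractOfLinear ((e.symm.toLinearMap ∘ₗ a).prod (b ∘ₗ L.subtype))
    (((r.i.hom ∘ₗ f.hom).coprod b).codRestrict L ?_) ?_) hprod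
  · rintro ⟨y, v⟩
    change g.hom (r.r.hom (r.i.hom (f.hom y) + (v - r.i.hom (r.r.hom v)))) = 0
    rw [map_add, map_sub, hir, hir, sub_self, add_zero, hfg.apply_apply_eq_zero]
  · intro v
    refine Subtype.ext ?_
    change r.i.hom (f.hom (e.symm (a v))) +
      ((v.1 - r.i.hom (r.r.hom v.1)) - r.i.hom (r.r.hom (v.1 - r.i.hom (r.r.hom v.1)))) = v.1
    rw [hfe, map_sub r.r.hom, hir, sub_self, map_zero, sub_zero]
    change r.i.hom (r.r.hom v.1) + _ = _
    abel

variable [IsArtinianRing A]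

/-- Special preenvelopes give one half of completeness, the pushout trick the other. A module right
orthogonal to the left perpendicular class splits off its own special preenvelope, hence lies in
`P`. -/
theorem IsCoresolving.isCompleteHereditaryCotorsionPair {P : ObjectProperty (ModuleCat.{u} A)}
    (hA : HasEnoughFGInjectives A) (hP : IsCoresolving P) (hPfin : IsCovariantlyFinite P) :
    IsCompleteHereditaryCotorsionPair (leftExtPerp P) P where
  cotorsionPair :=
    { left_iff := fun X => Iff.rfl
      right_iff := fun Y => by
        refine ⟨fun hY => ⟨hP.le_fg _ hY, fun X hX => hX.2 Y hY⟩, fun ⟨hfg, hY⟩ => ?_⟩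
        obtain ⟨E, Z, f, g, hE, hs, hZ⟩ := hP.exists_special_preenvelope hA hPfin Y hfg
        have hZfg := Module.Finite.of_isShortExact_right hs (hP.le_fg _ hE)
        obtain ⟨r⟩ := (hY Z ⟨hZfg, hZ⟩).nonempty_retract_left hs
        exact hP.summand r hE }
  hereditary :=
    { le_fg := fun X hX => hX.1
      projective := fun M hM hproj => ⟨hM, fun Y _ => extVanishes_of_projective hproj⟩
      extension := fun f g hs hX hZ => ⟨Module.Finite.of_isShortExact hs hX.1 hZ.1,
        fun W hW => ExtVanishes.middle_left hs (hX.2 W hW) (hZ.2 W hW)⟩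
      kernel := fun {X Y Z} f g hX hs hY hZ => ⟨hX, fun W hW => by
        -- The cosyzygy of `W` stays in `P`, so Ext²(Z, W) is controlled by Ext¹ of Z into a module
        -- of `P`.
        obtain ⟨I, i, hIfg, hI, hi⟩ := hA W (hP.le_fg _ hW)
        have hs' := isShortExact_range hi
        have hC := hP.cokernel _ _ hs' hW (hP.injective I hIfg hI)
        exact ExtVanishes.of_kernel hs (ExtVanishes.succ_of_cokernel hs' (hZ.2 _ hC)
          (extVanishes_of_injective hI 1)) (hY.2 W hW)⟩
      summand := fun r hY => ⟨Module.Finite.of_retract r hY.1,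
        fun W hW => (hY.2 W hW).retract_left r⟩ }
  complete_right := fun X hX => by
    obtain ⟨E, Z, f, g, hE, hs, hZ⟩ := hP.exists_special_preenvelope hA hPfin X hX
    exact ⟨E, Z, f, g, hE, ⟨Module.Finite.of_isShortExact_right hs (hP.le_fg _ hE), hZ⟩, hs⟩
  complete_left := fun X hX => by
    obtain ⟨n, p, hp⟩ := exists_projective_cover X hX
    have hs := isShortExact_ker hp
    have hQ : ModuleCat.isFG A (ModuleCat.of A (Fin n → A)) := by
      rw [ModuleCat.isFG_iff]; infer_instance
    have hΩ := Module.Finite.of_isShortExact_left hs hQ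
    obtain ⟨Y, Z, f, g, hY, hs', hZ⟩ := hP.exists_special_preenvelope hA hPfin _ hΩ
    obtain ⟨E, i, p', i', q', h1, h2⟩ := exists_pushout hs hs'
    exact ⟨Y, E, i, p', hY, ⟨Module.Finite.of_isShortExact h1 (hP.le_fg _ hY) hX, fun W hW =>
      ExtVanishes.middle_left h2 (extVanishes_of_projective (projective_fin_pow n)) (hZ W hW)⟩, h1⟩

theorem IsResolving.isCompleteHereditaryCotorsionPair {P : ObjectProperty (ModuleCat.{u} A)}
    (hA : HasEnoughFGInjectives A) (hP : IsResolving P) (hPfin : IsContravariantlyFinite P) :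
    IsCompleteHereditaryCotorsionPair P (rightExtPerp P) where
  cotorsionPair :=
    { left_iff := fun X => by
        refine ⟨fun hX => ⟨hP.le_fg _ hX, fun Y hY => hY.2 X hX⟩, fun ⟨hfg, hX⟩ => ?_⟩
        obtain ⟨Z, E, f, g, hE, hs, hZ⟩ := hP.exists_special_precover hPfin X hfg
        have hZfg := Module.Finite.of_isShortExact_left hs (hP.le_fg _ hE)
        obtain ⟨r⟩ := (hX Z ⟨hZfg, hZ⟩).nonempty_retract_right hs
        exact hP.summand r hE
      right_iff := fun Y => Iff.rfl }
  hereditary := hP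
  complete_right := fun X hX => by
    obtain ⟨I, i, hIfg, hI, hi⟩ := hA X hX
    have hs := isShortExact_range hi
    have hC := Module.Finite.of_isShortExact_right hs hIfg
    obtain ⟨K, G, f, g, hG, hs', hK⟩ := hP.exists_special_precover hPfin _ hC
    obtain ⟨E, i, p, i', p', h1, h2⟩ := exists_pullback hs hs'
    exact ⟨E, G, i, p, ⟨Module.Finite.of_isShortExact h1 hX (hP.le_fg _ hG), fun W hW =>
      ExtVanishes.middle_right h2 (hK W hW) (extVanishes_of_injective hI 0)⟩, hG, h1⟩
  complete_left := fun X hX => by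
    obtain ⟨Z, E, f, g, hE, hs, hZ⟩ := hP.exists_special_precover hPfin X hX
    exact ⟨Z, E, f, g, ⟨Module.Finite.of_isShortExact_left hs (hP.le_fg _ hE), hZ⟩, hE, hs⟩

end Cotorsion

/-! ### Matlis duality over a commutative artinian ring -/

section Duality

variable {k : Type u} [CommRing k]

theorem dualizingModule_injective (k : Type u) [CommRing k] :
    Module.Injective k (dualizingModule k) :=
  (isInjectiveEnvelope_dualizingEmbedding k).injective_module

theorem exists_extend_functional {M N : Type u} [AddCommGroup M] [Module k M] [AddCommGroup N]
    [Module k N] (i : M →ₗ[k] N) (hi : Function.Injective i) (f : M →ₗ[k] dualizingModule k) :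
    ∃ g : N →ₗ[k] dualizingModule k, ∀ x, g (i x) = f x :=
  (dualizingModule_injective k).out i hi f

/-- A nonzero element of the dualizing module killed by a maximal ideal spans all such elements. -/
theorem exists_smul_eq_of_annihilated (m : Ideal k) [hm : m.IsMaximal] {x y : dualizingModule k}
    (hx : x ≠ 0) (hmx : ∀ b ∈ m, b • x = 0) (hmy : ∀ b ∈ m, b • y = 0) : ∃ c : k, c • x = y := by
  by_cases hy : y = 0
  · exact ⟨0, by rw [zero_smul, hy]⟩
  let ι := dualizingEmbedding k
  have hι := isInjectiveEnvelope_dualizingEmbedding k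
  -- Such a `z` spans a copy of the field `k/m`. By essentiality some nonzero multiple of `z` lies
  -- in the image of `k / rad k`, and inverting the scalar modulo `m` brings `z` itself there.
  have key : ∀ z : dualizingModule k, z ≠ 0 → (∀ b ∈ m, b • z = 0) →
      ∃ a : k, ι (Submodule.Quotient.mk a) = z := by
    intro z hz hmz
    have h1 : Submodule.span k {z} ⊓ LinearMap.range ι ≠ ⊥ := fun h =>
      hz (by simpa using hι.essential _ h)
    obtain ⟨w, ⟨hw1, ⟨q, hq⟩⟩, hw0⟩ := Submodule.exists_mem_ne_zero_of_ne_bot h1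
    obtain ⟨c, rfl⟩ := Submodule.mem_span_singleton.1 hw1
    have hc : c ∉ m := fun hc => hw0 (hmz c hc)
    obtain ⟨d, hd⟩ := Ideal.IsMaximal.exists_inv hm hc
    obtain ⟨j, hj, hdj⟩ := hd
    obtain ⟨a, rfl⟩ := Submodule.Quotient.mk_surjective _ q
    refine ⟨d * a, ?_⟩
    have : (Submodule.Quotient.mk (d * a) : k ⧸ Ring.jacobson k) = d • Submodule.Quotient.mk a :=
      rfl
    rw [this, map_smul, hq, smul_smul]
    have h2 : (d * c + j) • z = z := by rw [hdj, one_smul]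
    rwa [add_smul, hmz j hj, add_zero] at h2
  obtain ⟨a, rfl⟩ := key x hx hmx
  obtain ⟨b, rfl⟩ := key y hy hmy
  have mem_iff : ∀ r : k, ι (Submodule.Quotient.mk r) = 0 ↔ r ∈ Ring.jacobson k := fun r => by
    rw [map_eq_zero_iff _ hι.injective, Submodule.Quotient.mk_eq_zero]
  have hma : ∀ r ∈ m, r * a ∈ Ring.jacobson k := fun r hr => by
    rw [← mem_iff, ← hmx r hr, ← map_smul]; rfl
  have hmb : ∀ r ∈ m, r * b ∈ Ring.jacobson k := fun r hr => by
    rw [← mem_iff, ← hmy r hr, ← map_smul]; rfl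
  -- Every maximal ideal `I ≠ m` contains `a`, since it is prime and contains `r * a` for some `r`
  -- in `m` outside `I`. With `a ∈ m` as well, `a` would be in the radical and `x` would be zero.
  have ham : a ∉ m := by
    intro ham
    refine hx ((mem_iff a).2 ?_)
    rw [Ring.jacobson_eq_sInf_isMaximal, Ideal.mem_sInf]
    intro I hI
    by_cases h : I = m
    · exact h ▸ ham
    · have hI' : I.IsMaximal := hI
      have : ¬ m ≤ I := fun hle => h (hm.eq_of_le hI'.ne_top hle).symm
      obtain ⟨r, hr, hrI⟩ := Set.not_subset.1 this
      have h5 := hma r hr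
      rw [Ring.jacobson_eq_sInf_isMaximal, Ideal.mem_sInf] at h5
      exact (hI'.isPrime.mem_or_mem (h5 hI)).resolve_left hrI
  obtain ⟨d, j, hj, hdj⟩ := Ideal.IsMaximal.exists_inv hm ham
  -- Here `d` inverts `a` modulo `m`, with `d * a + j = 1`; the error term `j * b` is in the
  -- radical.
  refine ⟨b * d, ?_⟩
  have h6 : ι (Submodule.Quotient.mk (j * b)) = 0 := (mem_iff _).2 (hmb j hj)
  have h7 : (Submodule.Quotient.mk b : k ⧸ Ring.jacobson k) =
      (b * d) • Submodule.Quotient.mk a + Submodule.Quotient.mk (j * b) := by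
    rw [← Submodule.Quotient.mk_smul, ← Submodule.Quotient.mk_add]
    congr 1
    have : b = b * (d * a + j) := by rw [hdj, mul_one]
    rw [smul_eq_mul]
    linear_combination this
  rw [h7, map_add, h6, add_zero, map_smul]

/-- A functional is determined by its value at a generator `x`, and that value is killed by the
maximal annihilator of `x`. All such values are multiples of any nonzero one. -/
theorem length_dual_simple (M : Type u) [AddCommGroup M] [Module k M] [IsSimpleModule k M] :
    Module.length k (M →ₗ[k] dualizingModule k) ≤ 1 := by
  by_cases hsub : Subsingleton (M →ₗ[k] dualizingModule k)
  · rw [Module.length_eq_zero]; exact zero_le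
  refine le_of_eq (Module.length_eq_one_iff.2 ?_)
  rw [not_subsingleton_iff_nontrivial] at hsub
  have := IsSimpleModule.nontrivial k M
  obtain ⟨x, hx⟩ := exists_ne (0 : M)
  let m : Ideal k := LinearMap.ker (LinearMap.toSpanSingleton k M x)
  have hm : m.IsMaximal := IsSimpleModule.ker_toSpanSingleton_isMaximal k hx
  have hgen : ∀ y : M, ∃ c : k, c • x = y := IsSimpleModule.toSpanSingleton_surjective k hx
  have hmf : ∀ (f : M →ₗ[k] dualizingModule k), ∀ b ∈ m, b • f x = 0 := fun f b hb => by
    have : b • x = 0 := hb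
    rw [← map_smul, this, map_zero]
  refine (isSimpleModule_iff_toSpanSingleton_surjective).2 ⟨hsub, fun f hf g => ?_⟩
  have hfx : f x ≠ 0 := fun h => hf (LinearMap.ext fun y => by
    obtain ⟨c, rfl⟩ := hgen y
    rw [map_smul, h, smul_zero, LinearMap.zero_apply])
  obtain ⟨c, hc⟩ := exists_smul_eq_of_annihilated m hfx (hmf f) (hmf g)
  refine ⟨c, LinearMap.ext fun y => ?_⟩
  obtain ⟨d, rfl⟩ := hgen y
  rw [map_smul, map_smul, ← hc]
  rfl

/-- Induction along a composition series, using left exactness of the dual. The inequality suffices: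
used twice, it bounds the length of the double dual. -/
theorem length_dual_le {M : Type u} [AddCommGroup M] [Module k M] (hM : IsFiniteLength k M) :
    Module.length k (M →ₗ[k] dualizingModule k) ≤ Module.length k M := by
  induction hM with
  | of_subsingleton =>
    rw [Module.length_eq_zero (M := _ →ₗ[k] _)]
    exact zero_le
  | @of_simple_quotient M _ _ N hs hN ih =>
    have h1 := Module.length_eq_add_of_exact N.subtype N.mkQ N.subtype_injective
      N.mkQ_surjective (LinearMap.exact_subtype_mkQ N)
    have h2 : Module.length k (M ⧸ N) = 1 := Module.length_eq_one k _
    let res : (M →ₗ[k] dualizingModule k) →ₗ[k] (N →ₗ[k] dualizingModule k) :=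
      LinearMap.lcomp k _ N.subtype
    let inf : ((M ⧸ N) →ₗ[k] dualizingModule k) →ₗ[k] (M →ₗ[k] dualizingModule k) :=
      LinearMap.lcomp k _ N.mkQ
    have hinf : Function.Injective inf := fun f g h =>
      Submodule.linearMap_qext _ h
    have hex : Function.Exact inf res.rangeRestrict := by
      intro f
      constructor
      · intro hf
        have hf' : res f = 0 := congrArg Subtype.val hf
        refine ⟨N.liftQ f fun y hy => ?_, LinearMap.ext fun y => rfl⟩
        exact congrArg (fun l => l ⟨y, hy⟩) hf'
      · rintro ⟨g, rfl⟩
        refine Subtype.ext (LinearMap.ext fun y => ?_)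
        change g (N.mkQ (y : M)) = 0
        rw [show N.mkQ (y : M) = 0 by simp, map_zero]
    have h3 := Module.length_eq_add_of_exact inf res.rangeRestrict hinf
      res.surjective_rangeRestrict hex
    rw [h3, h1, h2, add_comm]
    refine add_le_add ((Module.length_le_of_injective (LinearMap.range res).subtype
      (Submodule.subtype_injective _)).trans ih) (length_dual_simple (M ⧸ N))

variable [IsArtinianRing k]

/-- There are finitely many maximal ideals, so by primality some element lies in all of them but
`m`. Its class in `k / rad k` spans a copy of `k/m`, which shows that every simple module embeds in
the dualizing module. -/
theorem exists_annihilated_mod_jacobson (m : Ideal k) [m.IsMaximal] :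
    ∃ a : k, a ∉ m ∧ ∀ b ∈ m, b * a ∈ Ring.jacobson k := by
  have hfin : {I : Ideal k | I.IsMaximal}.Finite := IsArtinianRing.setOfPred_isMaximal_finite k
  have h1 : ∃ a : k, a ∉ m ∧ ∀ I : Ideal k, I.IsMaximal → I ≠ m → a ∈ I := by
    have hnot : ¬ (hfin.toFinset.erase m).inf id ≤ m := by
      intro h
      obtain ⟨I, hI, hIm⟩ := (Ideal.IsPrime.inf_le' inferInstance).1 h
      have hI' := Finset.mem_erase.1 hI
      have hmax : I.IsMaximal := hfin.mem_toFinset.1 hI'.2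
      exact hI'.1 (hmax.eq_of_le (Ideal.IsMaximal.ne_top ‹_›) hIm)
    obtain ⟨a, ha, ham⟩ := Set.not_subset.1 hnot
    refine ⟨a, ham, fun I hI hne => ?_⟩
    exact (Finset.inf_le (f := id) (Finset.mem_erase.2 ⟨hne, hfin.mem_toFinset.2 hI⟩) :
      (hfin.toFinset.erase m).inf id ≤ I) ha
  obtain ⟨a, ham, ha⟩ := h1
  refine ⟨a, ham, fun b hb => ?_⟩
  rw [Ring.jacobson_eq_sInf_isMaximal, Ideal.mem_sInf]
  intro I hI
  by_cases h : I = m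
  · subst h
    exact I.mul_mem_right a hb
  · exact I.mul_mem_left b (ha I hI h)

/-- The functionals separate the elements of a module. -/
theorem exists_functional_ne_zero {M : Type u} [AddCommGroup M] [Module k M] {x : M} (hx : x ≠ 0) :
    ∃ f : M →ₗ[k] dualizingModule k, f x ≠ 0 := by
  let I : Ideal k := LinearMap.ker (LinearMap.toSpanSingleton k M x)
  have hI : I ≠ ⊤ := by
    intro h
    have : (1 : k) ∈ I := h ▸ Submodule.mem_top
    exact hx (by simpa [I] using this)
  obtain ⟨m, hm, hIm⟩ := Ideal.exists_le_maximal I hI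
  obtain ⟨a, ha, ham⟩ := exists_annihilated_mod_jacobson m
  -- This map kills `m`, hence `I`, and so induces a nonzero functional on the submodule `kx ≅ k/I`,
  -- which extends by injectivity.
  let φ : k →ₗ[k] (k ⧸ Ring.jacobson k) :=
    LinearMap.toSpanSingleton k _ (Submodule.Quotient.mk a)
  have hIφ : I ≤ LinearMap.ker φ := fun b hb => by
    change b • (Submodule.Quotient.mk a : k ⧸ Ring.jacobson k) = 0
    rw [← Submodule.Quotient.mk_smul, Submodule.Quotient.mk_eq_zero]
    exact ham b (hIm hb)
  let ψ : (k ⧸ I) →ₗ[k] M := I.liftQ (LinearMap.toSpanSingleton k M x) le_rfl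
  have hψ : Function.Injective ψ := LinearMap.ker_eq_bot.1 (Submodule.ker_liftQ_eq_bot _ _ _ le_rfl)
  obtain ⟨f, hf⟩ := exists_extend_functional ψ hψ (dualizingEmbedding k ∘ₗ I.liftQ φ hIφ)
  refine ⟨f, fun h0 => ?_⟩
  have h1 := hf (Submodule.Quotient.mk 1)
  have h2 : ψ (Submodule.Quotient.mk 1) = x := one_smul k x
  rw [h2, h0] at h1
  have h3 : (I.liftQ φ hIφ) (Submodule.Quotient.mk 1) = 0 :=
    (isInjectiveEnvelope_dualizingEmbedding k).injective (by rw [map_zero]; exact h1.symm)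
  have h4 : (1 : k) • (Submodule.Quotient.mk a : k ⧸ Ring.jacobson k) = 0 := h3
  rw [one_smul, Submodule.Quotient.mk_eq_zero, Ring.jacobson_eq_sInf_isMaximal,
    Ideal.mem_sInf] at h4
  exact ha (h4 hm)

theorem dual_eval_injective {M : Type u} [AddCommGroup M] [Module k M] {x y : M}
    (h : ∀ f : M →ₗ[k] dualizingModule k, f x = f y) : x = y := by
  by_contra hne
  obtain ⟨f, hf⟩ := exists_functional_ne_zero (k := k) (sub_ne_zero.2 hne)
  exact hf (by rw [map_sub, h, sub_self])

theorem isFiniteLength_of_finite (M : Type u) [AddCommGroup M] [Module k M] [Module.Finite k M] :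
    IsFiniteLength k M :=
  isFiniteLength_iff_isNoetherian_isArtinian.2 ⟨inferInstance, inferInstance⟩

theorem isFiniteLength_dual (M : Type u) [AddCommGroup M] [Module k M] [Module.Finite k M] :
    IsFiniteLength k (M →ₗ[k] dualizingModule k) := by
  have h := isFiniteLength_of_finite (k := k) M
  rw [← Module.length_ne_top_iff] at h ⊢
  exact ne_top_of_le_ne_top h (length_dual_le (isFiniteLength_of_finite M))

instance finite_dual (M : Type u) [AddCommGroup M] [Module k M] [Module.Finite k M] :
    Module.Finite k (M →ₗ[k] dualizingModule k) := by
  have := (isFiniteLength_iff_isNoetherian_isArtinian.1 (isFiniteLength_dual (k := k) M)).1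
  infer_instance

/-- A finitely generated module is reflexive for the duality. -/
theorem exists_eq_dual_eval {M : Type u} [AddCommGroup M] [Module k M] [Module.Finite k M]
    (χ : (M →ₗ[k] dualizingModule k) →ₗ[k] dualizingModule k) :
    ∃ x : M, ∀ f, χ f = f x := by
  let D := M →ₗ[k] dualizingModule k
  let ev : M →ₗ[k] (D →ₗ[k] dualizingModule k) := LinearMap.applyₗ
  have hev : Function.Injective ev := fun x y h =>
    dual_eval_injective fun f => congrArg (fun l => l f) h
  have h1 := Module.length_eq_add_of_exact ev (LinearMap.range ev).mkQ hev
    (Submodule.mkQ_surjective _) (LinearMap.exact_map_mkQ_range ev)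
  -- The evaluation map is injective into a module that is no longer than `M`, so its cokernel has
  -- length zero.
  have h2 : Module.length k (D →ₗ[k] dualizingModule k) ≤ Module.length k M :=
    (length_dual_le (isFiniteLength_dual M)).trans (length_dual_le (isFiniteLength_of_finite M))
  rw [h1] at h2
  have hM := Module.length_ne_top_iff.2 (isFiniteLength_of_finite (k := k) M)
  have h3 : Module.length k ((D →ₗ[k] dualizingModule k) ⧸ LinearMap.range ev) = 0 := by
    have h4 : Module.length k M + Module.length k ((D →ₗ[k] dualizingModule k) ⧸
      LinearMap.range ev) ≤ Module.length k M + 0 := by rwa [add_zero]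
    exact nonpos_iff_eq_zero.1 ((ENat.add_le_add_iff_left hM).1 h4)
  rw [Module.length_eq_zero_iff, Submodule.Quotient.subsingleton_iff] at h3
  obtain ⟨x, hx⟩ := LinearMap.range_eq_top.1 h3 χ
  exact ⟨x, fun f => congrArg (fun l => l f) hx.symm⟩

end Duality

/-! ### Injective modules over an artin algebra -/

namespace ArtinDual

variable {k S V : Type u} [CommRing k] [Ring S] [AddCommGroup V] [Module k V]

instance : Module k (ArtinDual k V) := inferInstanceAs (Module k (V →ₗ[k] dualizingModule k))

instance [IsArtinianRing k] [Module.Finite k V] : Module.Finite k (ArtinDual k V) :=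
  inferInstanceAs (Module.Finite k (V →ₗ[k] dualizingModule k))

instance [Algebra k S] [Module S V] [IsScalarTower k S V] [SMulCommClass S k V] :
    IsScalarTower k Sᵐᵒᵖ (ArtinDual k V) where
  smul_assoc c s f := DFunLike.ext _ _ fun v =>
    (congrArg f (smul_assoc c s.unop v)).trans (LinearMap.map_smul (f : V →ₗ[k] _) c _)

end ArtinDual

/-- The action of `k` on a module over a `k`-algebra. -/
abbrev moduleOfAlgebra (k A M : Type u) [CommRing k] [Ring A] [Algebra k A] [AddCommGroup M]
    [Module A M] : Module k M := Module.compHom M (algebraMap k A)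

theorem isScalarTower_moduleOfAlgebra (k A M : Type u) [CommRing k] [Ring A] [Algebra k A]
    [AddCommGroup M] [Module A M] :
    letI := moduleOfAlgebra k A M
    IsScalarTower k A M :=
  letI := moduleOfAlgebra k A M
  ⟨fun c a m => by rw [Algebra.smul_def, mul_smul]; rfl⟩

section DualOfAlgebra

variable {k R : Type u} [CommRing k] [Ring R] [Algebra k R]

/-- A functional on a right module `X` induces a map of right modules from `X` to `DR`. -/
def toArtinDual {X : Type u} [AddCommGroup X] [Module Rᵐᵒᵖ X] [Module k X] [IsScalarTower k Rᵐᵒᵖ X]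
    (ξ : X →ₗ[k] dualizingModule k) : X →ₗ[Rᵐᵒᵖ] ArtinDual k R where
  toFun x := (
    { toFun r := ξ (MulOpposite.op r • x)
      map_add' r s := by rw [MulOpposite.op_add, add_smul, map_add]
      map_smul' c r := by rw [MulOpposite.op_smul, smul_assoc, map_smul, RingHom.id_apply] } :
    R →ₗ[k] dualizingModule k)
  map_add' x y := DFunLike.ext _ _ fun r => by
    change ξ (MulOpposite.op r • (x + y)) = ξ (MulOpposite.op r • x) + ξ (MulOpposite.op r • y)
    rw [smul_add, map_add]
  map_smul' s x := DFunLike.ext _ _ fun r => by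
    change ξ (MulOpposite.op r • s • x) = ξ (MulOpposite.op (s.unop * r) • x)
    rw [MulOpposite.op_mul, mul_smul, MulOpposite.op_unop]

theorem toArtinDual_apply {X : Type u} [AddCommGroup X] [Module Rᵐᵒᵖ X] [Module k X]
    [IsScalarTower k Rᵐᵒᵖ X] (ξ : X →ₗ[k] dualizingModule k) (x : X) (r : R) :
    toArtinDual ξ x r = ξ (MulOpposite.op r • x) := rfl

theorem ArtinDual.apply_eq_smul_one (f : ArtinDual k R) (r : R) :
    f r = (MulOpposite.op r • f) (1 : R) :=
  congrArg f (mul_one r).symm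

/-- The functional `x ↦ g(x)(1)` of a map `g : X → DR`. -/
def evalOne {X : Type u} [AddCommGroup X] [Module Rᵐᵒᵖ X] [Module k X] [IsScalarTower k Rᵐᵒᵖ X] :
    (X →ₗ[Rᵐᵒᵖ] ArtinDual k R) →ₗ[k] (X →ₗ[k] dualizingModule k) where
  toFun g :=
    { toFun x := g x (1 : R)
      map_add' x y := by rw [map_add]; rfl
      map_smul' c x := by
        rw [RingHom.id_apply, ← algebraMap_smul Rᵐᵒᵖ c x, map_smul, algebraMap_smul]
        rfl }
  map_add' _ _ := rfl
  map_smul' _ _ := rfl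

theorem evalOne_apply {X : Type u} [AddCommGroup X] [Module Rᵐᵒᵖ X] [Module k X]
    [IsScalarTower k Rᵐᵒᵖ X] (g : X →ₗ[Rᵐᵒᵖ] ArtinDual k R) (x : X) :
    evalOne g x = g x (1 : R) := rfl

theorem evalOne_toArtinDual {X : Type u} [AddCommGroup X] [Module Rᵐᵒᵖ X] [Module k X]
    [IsScalarTower k Rᵐᵒᵖ X] (ξ : X →ₗ[k] dualizingModule k) : evalOne (toArtinDual (R := R) ξ) = ξ :=
  LinearMap.ext fun x => congrArg ξ (one_smul Rᵐᵒᵖ x)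

/-- Maps `X → DR` are the same as functionals on `X`, and these extend because the dualizing module
is injective over `k`. -/
instance injective_artinDual : Module.Injective Rᵐᵒᵖ (ArtinDual k R) := by
  refine ⟨fun X Y _ _ _ _ i hi g => ?_⟩
  let := moduleOfAlgebra k Rᵐᵒᵖ X
  let := moduleOfAlgebra k Rᵐᵒᵖ Y
  have := isScalarTower_moduleOfAlgebra k Rᵐᵒᵖ X
  have := isScalarTower_moduleOfAlgebra k Rᵐᵒᵖ Y
  obtain ⟨ξ, hξ⟩ := exists_extend_functional (i.restrictScalars k) hi (evalOne g)
  refine ⟨toArtinDual ξ, fun x => DFunLike.ext _ _ fun r => ?_⟩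
  rw [toArtinDual_apply, ← map_smul, ArtinDual.apply_eq_smul_one (g x), ← map_smul]
  exact hξ _

instance injective_pow_artinDual (n : ℕ) : Module.Injective Rᵐᵒᵖ (Fin n → ArtinDual k R) := by
  refine ⟨fun X Y _ _ _ _ i hi g => ?_⟩
  choose h hh using fun j => injective_artinDual.out i hi (LinearMap.proj j ∘ₗ g)
  exact ⟨LinearMap.pi h, fun x => funext fun j => hh j x⟩

variable [IsArtinianRing k] [Module.Finite k R]

/-- The coordinates come from finitely many generators of `DX` over `k`: an element killed by all of
them is killed by every functional, hence is zero. -/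
theorem exists_embedding_artinDual (X : Type u) [AddCommGroup X] [Module Rᵐᵒᵖ X]
    [Module.Finite Rᵐᵒᵖ X] :
    ∃ (n : ℕ) (i : X →ₗ[Rᵐᵒᵖ] (Fin n → ArtinDual k R)), Function.Injective i := by
  let := moduleOfAlgebra k Rᵐᵒᵖ X
  have := isScalarTower_moduleOfAlgebra k Rᵐᵒᵖ X
  have : Module.Finite k X := Module.Finite.trans Rᵐᵒᵖ X
  obtain ⟨n, p, hp⟩ := Module.Finite.exists_fin' k (X →ₗ[k] dualizingModule k)
  refine ⟨n, LinearMap.pi fun j => toArtinDual (p (Pi.single j 1)), ?_⟩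
  rw [injective_iff_map_eq_zero]
  intro x hx
  refine dual_eval_injective (k := k) fun f => ?_
  obtain ⟨c, rfl⟩ := hp f
  rw [map_zero, pi_eq_sum_univ' c, map_sum, LinearMap.sum_apply]
  refine Finset.sum_eq_zero fun j _ => ?_
  have h1 : toArtinDual (R := R) (p (Pi.single j 1)) x = 0 := congrFun hx j
  have h2 : p (Pi.single j 1) x = 0 := by
    rw [← evalOne_toArtinDual (R := R) (p (Pi.single j 1)), evalOne_apply, h1]; rfl
  rw [map_smul, LinearMap.smul_apply, h2, smul_zero]

instance finite_artinDual : Module.Finite Rᵐᵒᵖ (ArtinDual k R) :=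
  Module.Finite.of_restrictScalars_finite k Rᵐᵒᵖ _

theorem hasEnoughFGInjectives (k R : Type u) [CommRing k] [IsArtinianRing k] [Ring R] [Algebra k R]
    [Module.Finite k R] : HasEnoughFGInjectives Rᵐᵒᵖ := fun X hX => by
  rw [ModuleCat.isFG_iff] at hX
  obtain ⟨n, i, hi⟩ := exists_embedding_artinDual (k := k) (R := R) X
  exact ⟨ModuleCat.of Rᵐᵒᵖ (Fin n → ArtinDual k R), ModuleCat.ofHom i,
    (ModuleCat.isFG_iff _).2 inferInstance, Module.injective_object_of_injective_module _ _, hi⟩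

end DualOfAlgebra

/-! ### The adjunction between `- ⊗_S V` and `Hom_R(V, -)` -/

namespace BimodTensor

section Lift

variable {S V M : Type u} [Ring S] [AddCommGroup V] [Module S V] [AddCommGroup M] [Module Sᵐᵒᵖ M]

theorem add_tmul (m m' : M) (v : V) : tmul S V (m + m') v = tmul S V m v + tmul S V m' v := by
  simp only [tmul, TensorProduct.add_tmul]
  exact map_add (QuotientAddGroup.mk' (balancedRelations S V M)) _ _

theorem smul_tmul (s : S) (m : M) (v : V) :
    tmul S V (MulOpposite.op s • m) v = tmul S V m (s • v) := by
  refine sub_eq_zero.1 ?_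
  refine (map_sub (QuotientAddGroup.mk' (balancedRelations S V M)) _ _).symm.trans ?_
  exact (QuotientAddGroup.eq_zero_iff _).2 (AddSubgroup.subset_closure ⟨m, s, v, rfl⟩)

theorem tmul_sum {ι : Type*} (s : Finset ι) (m : M) (v : ι → V) :
    tmul S V m (∑ i ∈ s, v i) = ∑ i ∈ s, tmul S V m (v i) :=
  map_sum (⟨⟨tmul S V m, tmul_zero S V m⟩, tmul_add S V m⟩ : V →+ BimodTensor S V M) v s

theorem zero_tmul (v : V) : tmul S V (0 : M) v = 0 := by
  have h := add_tmul (S := S) (0 : M) 0 v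
  rwa [add_zero, left_eq_add] at h

theorem sum_tmul {ι : Type*} (s : Finset ι) (m : ι → M) (v : V) :
    tmul S V (∑ i ∈ s, m i) v = ∑ i ∈ s, tmul S V (m i) v :=
  map_sum (⟨⟨fun m => tmul S V m v, zero_tmul v⟩, fun m m' => add_tmul m m' v⟩ :
    M →+ BimodTensor S V M) m s

/-- The additive map out of `M ⊗_S V` induced by a balanced biadditive map. -/
def lift {N : Type*} [AddCommGroup N] (φ : M →+ V →+ N)
    (h : ∀ (s : S) m v, φ (MulOpposite.op s • m) v = φ m (s • v)) : BimodTensor S V M →+ N :=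
  QuotientAddGroup.lift (balancedRelations S V M)
    (TensorProduct.liftAddHom φ fun r m v => by
      rw [map_zsmul, map_zsmul, AddMonoidHom.zsmul_apply]) (by
      rw [balancedRelations, AddSubgroup.closure_le]
      rintro _ ⟨m, s, v, rfl⟩
      refine AddMonoidHom.mem_ker.2 ?_
      rw [map_sub, TensorProduct.liftAddHom_tmul, TensorProduct.liftAddHom_tmul, h, sub_self])

theorem smul_tmul_right {R : Type u} [Ring R] [Module Rᵐᵒᵖ V] [SMulCommClass S Rᵐᵒᵖ V]
    (r : Rᵐᵒᵖ) (m : M) (v : V) : r • tmul S V m v = tmul S V m (r • v) := rfl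

end Lift

section Adjunction

variable (S R V : Type u) [Ring S] [Ring R] [AddCommGroup V] [Module S V] [Module Rᵐᵒᵖ V]
  [SMulCommClass S Rᵐᵒᵖ V]

/-- The map `M → Hom_R(V, N)` corresponding to a map `M ⊗_S V → N`. -/
def curry {M N : Type u} [AddCommGroup M] [Module Sᵐᵒᵖ M] [AddCommGroup N] [Module Rᵐᵒᵖ N]
    (f : BimodTensor S V M →ₗ[Rᵐᵒᵖ] N) : M →ₗ[Sᵐᵒᵖ] BimodHom R V N where
  toFun m := (
    { toFun v := f (tmul S V m v)
      map_add' v w := by rw [tmul_add, map_add]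
      map_smul' r v := by rw [← smul_tmul_right, map_smul, RingHom.id_apply] } : V →ₗ[Rᵐᵒᵖ] N)
  map_add' m m' := DFunLike.ext _ _ fun v => (congrArg f (add_tmul m m' v)).trans (map_add f _ _)
  map_smul' s m := DFunLike.ext _ _ fun v => congrArg f (smul_tmul s.unop m v)

/-- The map `M ⊗_S V → N` corresponding to a map `M → Hom_R(V, N)`. -/
def uncurry {M N : Type u} [AddCommGroup M] [Module Sᵐᵒᵖ M] [AddCommGroup N] [Module Rᵐᵒᵖ N]
    (g : M →ₗ[Sᵐᵒᵖ] BimodHom R V N) : BimodTensor S V M →ₗ[Rᵐᵒᵖ] N :=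
  let φ := lift (S := S) (V := V) (M := M) (N := N)
    (AddMonoidHom.mk' (fun m => AddMonoidHom.mk' (fun v => g m v) fun v w => map_add (g m) v w)
      fun m m' => AddMonoidHom.ext fun v => by
        change g (m + m') v = g m v + g m' v
        rw [map_add]; rfl)
    fun s m v => by
      change g (MulOpposite.op s • m) v = g m (s • v)
      rw [map_smul]; rfl
  { φ with
    map_smul' r x := by
      change φ (r • x) = r • φ x
      induction x using BimodTensor.induction with
      | zero => rw [smul_zero, map_zero, smul_zero]
      | tmul m v => exact LinearMap.map_smul (g m : V →ₗ[Rᵐᵒᵖ] N) r v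
      | add a b ha hb => rw [smul_add, map_add, ha, hb, map_add, smul_add] }

variable {S R V} in
theorem hom_ext {M N : Type u} [AddCommGroup M] [Module Sᵐᵒᵖ M] [AddCommGroup N]
    [Module Rᵐᵒᵖ N] {f g : BimodTensor S V M →ₗ[Rᵐᵒᵖ] N}
    (h : ∀ m v, f (tmul S V m v) = g (tmul S V m v)) : f = g := by
  refine LinearMap.ext fun x => ?_
  induction x using BimodTensor.induction with
  | zero => rw [map_zero, map_zero]
  | tmul m v => exact h m v
  | add a b ha hb => rw [map_add, map_add, ha, hb]

/-- The adjunction between `- ⊗_S V` and `Hom_R(V, -)`. -/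
def adjunction : tensorFunctor S R V ⊣ homFunctor S R V :=
  CategoryTheory.Adjunction.mkOfHomEquiv
    { homEquiv := fun _ _ =>
        { toFun := fun f => ModuleCat.ofHom (curry S R V f.hom)
          invFun := fun g => ModuleCat.ofHom (uncurry S R V g.hom)
          left_inv := fun _ => ModuleCat.hom_ext (hom_ext fun _ _ => rfl)
          right_inv := fun _ => ModuleCat.hom_ext (LinearMap.ext fun _ => rfl) }
      homEquiv_naturality_left_symm := fun _ _ => ModuleCat.hom_ext (hom_ext fun _ _ => rfl)
      homEquiv_naturality_right := fun _ _ => rfl }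

end Adjunction

end BimodTensor

/-- An adjunction restricts to inverse equivalences between full subcategories that it preserves
and on which its counit and unit are isomorphisms. -/
theorem InduceInverseEquivalences.of_adjunction {C D : Type*} [Category* C] [Category* D]
    {H : C ⥤ D} {L : D ⥤ C} (adj : L ⊣ H) {P : ObjectProperty C} {Q : ObjectProperty D}
    (hH : ∀ X, P X → Q (H.obj X)) (hL : ∀ Y, Q Y → P (L.obj Y))
    (hcounit : ∀ X, P X → IsIso (adj.counit.app X)) (hunit : ∀ Y, Q Y → IsIso (adj.unit.app Y)) :
    InduceInverseEquivalences H L P Q := by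
  let F : P.FullSubcategory ⥤ Q.FullSubcategory := Q.lift (P.ι ⋙ H) fun X => hH _ X.2
  let G : Q.FullSubcategory ⥤ P.FullSubcategory := P.lift (Q.ι ⋙ L) fun Y => hL _ Y.2
  have h1 (X : P.FullSubcategory) : IsIso (adj.counit.app X.1) := hcounit _ X.2
  have h2 (Y : Q.FullSubcategory) : IsIso (adj.unit.app Y.1) := hunit _ Y.2
  let ε : F ⋙ G ≅ 𝟭 _ := NatIso.ofComponents
    (fun X => P.fullyFaithfulι.preimageIso (asIso (adj.counit.app X.1)))
    (fun f => P.ι.map_injective (adj.counit.naturality f.hom))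
  let η : 𝟭 _ ≅ G ⋙ F := NatIso.ofComponents
    (fun Y => Q.fullyFaithfulι.preimageIso (asIso (adj.unit.app Y.1)))
    (fun f => Q.ι.map_injective (adj.unit.naturality f.hom))
  exact ⟨CategoryTheory.Equivalence.mk F G ε.symm η.symm, ⟨Iso.refl _⟩, ⟨Iso.refl _⟩⟩

/-! ### Modules presented by a bimodule -/

section Presented

variable {k S R V : Type u} [Ring S] [Ring R] [AddCommGroup V] [Module S V]
  [Module Rᵐᵒᵖ V] [SMulCommClass S Rᵐᵒᵖ V]

theorem map_eq_sum_single {A V Y : Type*} [Ring A] [AddCommGroup V] [Module A V]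
    [AddCommGroup Y] [Module A Y] {n : ℕ} (π : (Fin n → V) →ₗ[A] Y) (v : Fin n → V) :
    π v = ∑ j, π (Pi.single j (v j)) := by
  conv_lhs => rw [← Finset.univ_sum_single v]
  rw [map_sum]

variable (S R V) in
/-- Every endomorphism of `V_R` is given by the action of a unique element of `S`. -/
def IsBalancedBimodule : Prop :=
  Function.Bijective fun s : S => DistribSMul.toLinearMap Rᵐᵒᵖ V s

theorem IsBalancedBimodule.exists_coeff (hS : IsBalancedBimodule S R V) {n : ℕ}
    (f : V →ₗ[Rᵐᵒᵖ] (Fin n → V)) : ∃ s : Fin n → S, ∀ v j, f v j = s j • v := by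
  choose s hs using fun j => hS.2 (LinearMap.proj j ∘ₗ f)
  exact ⟨s, fun v j => (congrArg (fun l => l v) (hs j)).symm⟩

variable {Y : Type u} [AddCommGroup Y] [Module Rᵐᵒᵖ Y]

/-- The components of a map out of a power of `V`. -/
def component {n : ℕ} (π : (Fin n → V) →ₗ[Rᵐᵒᵖ] Y) (j : Fin n) : BimodHom R V Y :=
  π ∘ₗ LinearMap.single Rᵐᵒᵖ (fun _ => V) j

/-- When maps `V → Y` lift along `π`, this shows that the components of `π` generate `Hom(V, Y)`
over `S`. -/
theorem sum_smul_component {n : ℕ} (π : (Fin n → V) →ₗ[Rᵐᵒᵖ] Y) (q : V →ₗ[Rᵐᵒᵖ] (Fin n → V))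
    {s : Fin n → S} (hs : ∀ v j, q v j = s j • v) :
    ∑ j, MulOpposite.op (s j) • component π j = (π ∘ₗ q : V →ₗ[Rᵐᵒᵖ] Y) := by
  refine LinearMap.ext fun v => ?_
  have h : ∀ t : Finset (Fin n), (∑ j ∈ t, MulOpposite.op (s j) • component π j : BimodHom R V Y) v
      = ∑ j ∈ t, (MulOpposite.op (s j) • component π j : BimodHom R V Y) v := fun t =>
    LinearMap.sum_apply t (fun j => (MulOpposite.op (s j) • component π j : BimodHom R V Y)) v
  refine (h _).trans ?_
  rw [LinearMap.comp_apply, map_eq_sum_single]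
  refine Finset.sum_congr rfl fun j _ => ?_
  rw [hs]; rfl

-- Every tensor can be brought to the form `∑ πⱼ ⊗ vⱼ`, which the counit sends to `π v`. If `π v =
-- 0`, then `v` comes from `p`, whose entries act through `S`; moving them across the tensor sign
-- leaves the components of `π ∘ p = 0`.
open BimodTensor in
theorem bijective_counit (hS : IsBalancedBimodule S R V) {n m : ℕ} (π : (Fin n → V) →ₗ[Rᵐᵒᵖ] Y)
    (hπ : Function.Surjective π) (hlift : ∀ g : V →ₗ[Rᵐᵒᵖ] Y, ∃ h, π ∘ₗ h = g)
    (p : (Fin m → V) →ₗ[Rᵐᵒᵖ] (Fin n → V)) (hp : Function.Exact p π) :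
    Function.Bijective
      (uncurry S R V (LinearMap.id : BimodHom R V Y →ₗ[Sᵐᵒᵖ] BimodHom R V Y)) := by
  set ε := uncurry S R V (LinearMap.id : BimodHom R V Y →ₗ[Sᵐᵒᵖ] BimodHom R V Y)
  have hε (v : Fin n → V) : ε (∑ j, tmul S V (component π j) (v j)) = π v := by
    rw [map_sum, map_eq_sum_single]; rfl
  have hgen (z : BimodTensor S V (BimodHom R V Y)) :
      ∃ v : Fin n → V, z = ∑ j, tmul S V (component π j) (v j) := by
    induction z using BimodTensor.induction with
    | zero => exact ⟨0, by simp only [Pi.zero_apply, BimodTensor.tmul_zero, Finset.sum_const_zero]⟩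
    | tmul g v =>
      obtain ⟨h, hh⟩ := hlift g
      obtain ⟨s, hs⟩ := hS.exists_coeff h
      refine ⟨fun j => s j • v, ?_⟩
      rw [← show _ = g from (sum_smul_component π h hs).trans hh, sum_tmul]
      exact Finset.sum_congr rfl fun j _ => smul_tmul _ _ _
    | add a b ha hb =>
      obtain ⟨v, rfl⟩ := ha
      obtain ⟨w, rfl⟩ := hb
      exact ⟨v + w, by simp only [Pi.add_apply, BimodTensor.tmul_add, Finset.sum_add_distrib]⟩
  refine ⟨(injective_iff_map_eq_zero ε).2 fun z hz => ?_, fun y => ?_⟩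
  · obtain ⟨v, rfl⟩ := hgen z
    rw [hε] at hz
    obtain ⟨w, rfl⟩ := (hp v).1 hz
    choose s hs using fun l =>
      hS.exists_coeff (p ∘ₗ LinearMap.single Rᵐᵒᵖ (fun _ : Fin m => V) l)
    have hw (j : Fin n) : p w j = ∑ l, s l j • w l := by
      rw [map_eq_sum_single, Finset.sum_apply]
      exact Finset.sum_congr rfl fun l _ => hs l (w l) j
    simp only [hw, tmul_sum]
    rw [Finset.sum_comm]
    refine Finset.sum_eq_zero fun l _ => ?_
    have h0 : ∑ j, MulOpposite.op (s l j) • component π j = 0 :=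
      (sum_smul_component π _ (hs l)).trans
        (LinearMap.ext fun v => hp.apply_apply_eq_zero _)
    simp only [← smul_tmul]
    rw [← sum_tmul, h0, zero_tmul]
  · obtain ⟨v, rfl⟩ := hπ y
    exact ⟨_, hε v⟩

variable (S R V) in
/-- The map `Sⁿ → Hom_R(V, Vⁿ)` given by the action of `S` on `V`. -/
def powMap (n : ℕ) : (Fin n → Sᵐᵒᵖ) →ₗ[Sᵐᵒᵖ] BimodHom R V (Fin n → V) where
  toFun c := (LinearMap.pi fun j => DistribSMul.toLinearMap Rᵐᵒᵖ V (c j).unop :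
    V →ₗ[Rᵐᵒᵖ] (Fin n → V))
  map_add' c d := DFunLike.ext _ _ fun v => funext fun j => add_smul (c j).unop (d j).unop v
  map_smul' t c := DFunLike.ext _ _ fun v => funext fun j => mul_smul (c j).unop t.unop v

theorem IsBalancedBimodule.bijective_powMap (hS : IsBalancedBimodule S R V) (n : ℕ) :
    Function.Bijective (powMap S R V n) := by
  refine ⟨fun c d h => funext fun j => MulOpposite.unop_injective (hS.1 (LinearMap.ext fun v => ?_)),
    fun f => ?_⟩
  · exact congrFun (congrArg (fun l : BimodHom R V (Fin n → V) => l v) h) j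
  · obtain ⟨s, hs⟩ := hS.exists_coeff f
    exact ⟨fun j => MulOpposite.op (s j), LinearMap.ext fun v => funext fun j => (hs v j).symm⟩

theorem IsBalancedBimodule.projective_pow (hS : IsBalancedBimodule S R V) (n : ℕ) :
    Projective (ModuleCat.of Sᵐᵒᵖ (BimodHom R V (Fin n → V))) :=
  have := Module.Projective.of_equiv (LinearEquiv.ofBijective _ (hS.bijective_powMap n))
  (IsProjective.iff_projective _).1 this

theorem IsBalancedBimodule.finite_pow (hS : IsBalancedBimodule S R V) (n : ℕ) :
    Module.Finite Sᵐᵒᵖ (BimodHom R V (Fin n → V)) :=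
  Module.Finite.of_surjective _ (hS.bijective_powMap n).2

variable [CommRing k] [Algebra k R]

/-- Postcomposition with a linear map over a `k`-algebra is `k`-linear. -/
def postcomp (k : Type u) [CommRing k] [Algebra k R] (N : Type u) [AddCommGroup N] [Module Rᵐᵒᵖ N]
    {Y Z : Type u} [AddCommGroup Y] [Module Rᵐᵒᵖ Y] [Module k Y] [IsScalarTower k Rᵐᵒᵖ Y]
    [AddCommGroup Z] [Module Rᵐᵒᵖ Z] [Module k Z] [IsScalarTower k Rᵐᵒᵖ Z] (f : Y →ₗ[Rᵐᵒᵖ] Z) :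
    (N →ₗ[Rᵐᵒᵖ] Y) →ₗ[k] (N →ₗ[Rᵐᵒᵖ] Z) where
  toFun g := f ∘ₗ g
  map_add' g h := LinearMap.ext fun x => map_add f (g x) (h x)
  map_smul' c g := LinearMap.ext fun x => f.map_smul_of_tower c (g x)

theorem exists_factor_of_surjective {A B E : Type*} [AddCommGroup A] [Module k A] [AddCommGroup B]
    [Module k B] [AddCommGroup E] [Module k E] (p : A →ₗ[k] B) (hp : Function.Surjective p)
    (f : A →ₗ[k] E) (hf : ∀ a, p a = 0 → f a = 0) : ∃ g : B →ₗ[k] E, ∀ a, g (p a) = f a := by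
  refine ⟨(LinearMap.ker p).liftQ f hf ∘ₗ (p.quotKerEquivOfSurjective hp).symm.toLinearMap,
    fun a => ?_⟩
  have : (p.quotKerEquivOfSurjective hp).symm (p a) = (LinearMap.ker p).mkQ a :=
    (p.quotKerEquivOfSurjective hp).symm_apply_eq.2 rfl
  rw [LinearMap.comp_apply]
  exact congrArg _ this

variable [Module k V] [IsScalarTower k Rᵐᵒᵖ V] {N : Type u} [AddCommGroup N] [Module Rᵐᵒᵖ N]
  {M : Type u} [AddCommGroup M] [Module Sᵐᵒᵖ M]

/-- A balanced pairing of `Hom_R(V, Y)` and `Hom_R(N, V)` factors through composition, if `Y` has a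
presentation by powers of `V` along which the maps from `V` and from `N` lift. -/
theorem exists_functional_of_pairing [Module k Y] [IsScalarTower k Rᵐᵒᵖ Y]
    (hS : IsBalancedBimodule S R V) {n : ℕ} (π : (Fin n → V) →ₗ[Rᵐᵒᵖ] Y)
    (hV : ∀ g : V →ₗ[Rᵐᵒᵖ] Y, ∃ h, π ∘ₗ h = g) (hN : ∀ g : N →ₗ[Rᵐᵒᵖ] Y, ∃ h, π ∘ₗ h = g)
    (hker : ∀ g : N →ₗ[Rᵐᵒᵖ] (Fin n → V), π ∘ₗ g = 0 →
      ∃ (m : ℕ) (p : (Fin m → V) →ₗ[Rᵐᵒᵖ] (Fin n → V)) (b : N →ₗ[Rᵐᵒᵖ] (Fin m → V)),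
        π ∘ₗ p = 0 ∧ g = p ∘ₗ b)
    (ψ : BimodHom R V Y →ₗ[Sᵐᵒᵖ] M) (ev : M →+ ((N →ₗ[Rᵐᵒᵖ] V) →ₗ[k] dualizingModule k))
    (hev : ∀ m (s : S) g, ev (MulOpposite.op s • m) g =
      ev m (DistribSMul.toLinearMap Rᵐᵒᵖ V s ∘ₗ g)) :
    ∃ φ : (N →ₗ[Rᵐᵒᵖ] Y) →ₗ[k] dualizingModule k,
      ∀ (f : V →ₗ[Rᵐᵒᵖ] Y) (g : N →ₗ[Rᵐᵒᵖ] V), ev (ψ f) g = φ (f ∘ₗ g) := by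
  let φ₀ : (N →ₗ[Rᵐᵒᵖ] (Fin n → V)) →ₗ[k] dualizingModule k :=
    ∑ j, ev (ψ (component π j)) ∘ₗ postcomp k N (LinearMap.proj j)
  have h0 (q : V →ₗ[Rᵐᵒᵖ] (Fin n → V)) (g : N →ₗ[Rᵐᵒᵖ] V) :
      φ₀ (q ∘ₗ g) = ev (ψ (π ∘ₗ q : V →ₗ[Rᵐᵒᵖ] Y)) g := by
    obtain ⟨s, hs⟩ := hS.exists_coeff q
    rw [← sum_smul_component π q hs, map_sum, map_sum, LinearMap.sum_apply, LinearMap.sum_apply]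
    refine Finset.sum_congr rfl fun j _ => ?_
    rw [map_smul, hev]
    exact congrArg (ev _) (LinearMap.ext fun x => hs (g x) j)
  -- `φ₀` descends from `Hom(N, Vⁿ)` to `Hom(N, Y)`: a map killed by `π` factors as `p ∘ b`, and on
  -- such maps `φ₀` is computed from `π ∘ p = 0`.
  obtain ⟨φ, hφ⟩ := exists_factor_of_surjective (postcomp k N π) hN φ₀ fun g hg => by
    obtain ⟨m, p, b, hp, rfl⟩ := hker g hg
    have hb : p ∘ₗ b = ∑ l, (p ∘ₗ LinearMap.single Rᵐᵒᵖ (fun _ => V) l) ∘ₗ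
        (LinearMap.proj l ∘ₗ b) := LinearMap.ext fun x => by
      rw [LinearMap.comp_apply, map_eq_sum_single, LinearMap.sum_apply]; rfl
    rw [hb, map_sum]
    refine Finset.sum_eq_zero fun l _ => ?_
    rw [h0, ← LinearMap.comp_assoc, hp, LinearMap.zero_comp]
    have : ψ (0 : V →ₗ[Rᵐᵒᵖ] Y) = 0 := map_zero ψ
    rw [this, map_zero, LinearMap.zero_apply]
  refine ⟨φ, fun f g => ?_⟩
  obtain ⟨q, rfl⟩ := hV f
  rw [← h0, ← hφ]
  rfl

/-- Since `Hom(N, Y)` embeds in `Hom(N, Z)`, the functional `φ` extends to some `φ'`; as `ev` is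
bijective, `g ↦ φ' (f ∘ g)` is represented by an element of `M`, which is the value of the extended
map at `f`. -/
theorem exists_extend_of_functional [Module k Y] [IsScalarTower k Rᵐᵒᵖ Y] {Z : Type u}
    [AddCommGroup Z] [Module Rᵐᵒᵖ Z] [Module k Z] [IsScalarTower k Rᵐᵒᵖ Z]
    (ψ : BimodHom R V Y →ₗ[Sᵐᵒᵖ] M) (ev : M →+ ((N →ₗ[Rᵐᵒᵖ] V) →ₗ[k] dualizingModule k))
    (hbij : Function.Bijective ev)
    (hev : ∀ m (s : S) g, ev (MulOpposite.op s • m) g =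
      ev m (DistribSMul.toLinearMap Rᵐᵒᵖ V s ∘ₗ g))
    (φ : (N →ₗ[Rᵐᵒᵖ] Y) →ₗ[k] dualizingModule k)
    (hφ : ∀ (f : V →ₗ[Rᵐᵒᵖ] Y) (g : N →ₗ[Rᵐᵒᵖ] V), ev (ψ f) g = φ (f ∘ₗ g))
    (i : Y →ₗ[Rᵐᵒᵖ] Z) (hi : Function.Injective i) :
    ∃ ψ' : BimodHom R V Z →ₗ[Sᵐᵒᵖ] M, ∀ f : BimodHom R V Y, ψ' (BimodHom.map S R V i f) = ψ f := by
  obtain ⟨φ', hφ'⟩ := exists_extend_functional (postcomp k N i)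
    (fun g h hgh => LinearMap.ext fun x => hi (congrArg (fun l => l x) hgh)) φ
  let θ (f : V →ₗ[Rᵐᵒᵖ] Z) : (N →ₗ[Rᵐᵒᵖ] V) →ₗ[k] dualizingModule k := φ' ∘ₗ postcomp k N f
  choose ψ' hψ' using fun f : V →ₗ[Rᵐᵒᵖ] Z => hbij.2 (θ f)
  refine ⟨⟨⟨ψ', fun f g => hbij.1 ?_⟩, fun s f => hbij.1 (LinearMap.ext fun g => ?_)⟩,
    fun f => hbij.1 (LinearMap.ext fun g => ?_)⟩
  · rw [map_add, hψ' f, hψ' g]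
    refine (hψ' _).trans (LinearMap.ext fun l => ?_)
    rw [LinearMap.add_apply]
    exact map_add φ' (f ∘ₗ l : N →ₗ[Rᵐᵒᵖ] Z) (g ∘ₗ l : N →ₗ[Rᵐᵒᵖ] Z)
  · have h1 := hev (ψ' f) s.unop g
    rw [MulOpposite.op_unop, hψ' f] at h1
    refine Eq.trans ?_ h1.symm
    exact congrArg (fun l => l g) (hψ' _)
  · exact (congrArg (fun l => l g) (hψ' (i ∘ₗ (f : V →ₗ[Rᵐᵒᵖ] Y)))).trans
      ((hφ' (LinearMap.comp (f : V →ₗ[Rᵐᵒᵖ] Y) g)).trans (hφ f g).symm)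

end Presented

/-! ### Classes of modules generated by a bimodule -/

section Generated

theorem exists_comp_eq_of_exact {A X Y Z N : Type*} [Ring A] [AddCommGroup X] [Module A X]
    [AddCommGroup Y] [Module A Y] [AddCommGroup Z] [Module A Z] [AddCommGroup N] [Module A N]
    {f : X →ₗ[A] Y} {g : Y →ₗ[A] Z} (hf : Function.Injective f) (hfg : Function.Exact f g)
    (h : N →ₗ[A] Y) (hgh : ∀ x, g (h x) = 0) : ∃ l : N →ₗ[A] X, f ∘ₗ l = h := by
  let e := LinearEquiv.ofInjective f hf
  refine ⟨e.symm.toLinearMap ∘ₗ h.codRestrict _ fun x => (hfg _).1 (hgh x), LinearMap.ext fun x => ?_⟩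
  exact congrArg Subtype.val (e.apply_symm_apply _)

theorem ExtVanishes.exists_lift {A N V Y : Type u} [Ring A] [AddCommGroup N] [Module A N]
    [AddCommGroup V] [Module A V] [AddCommGroup Y] [Module A Y] {π : V →ₗ[A] Y}
    (h : ExtVanishes (ModuleCat.of A N) (ModuleCat.of A (LinearMap.ker π)) 1)
    (hπ : Function.Surjective π) (g : N →ₗ[A] Y) : ∃ l, π ∘ₗ l = g := by
  obtain ⟨l, hl⟩ := h.lift (isShortExact_ker hπ) (ModuleCat.ofHom g)
  exact ⟨l.hom, congrArg ModuleCat.Hom.hom hl⟩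

variable {k S R V : Type u} [Ring S] [Ring R] [AddCommGroup V] [Module S V]
  [Module Rᵐᵒᵖ V] [SMulCommClass S Rᵐᵒᵖ V]

variable (S) in
theorem ExtVanishes.isShortExact_homFunctor {X Y Z : ModuleCat.{u} Rᵐᵒᵖ} {f : X ⟶ Y} {g : Y ⟶ Z}
    (h : ExtVanishes (ModuleCat.of Rᵐᵒᵖ V) X 1) (hs : IsShortExact f g) :
    IsShortExact ((homFunctor S R V).map f) ((homFunctor S R V).map g) := by
  obtain ⟨hf, hfg, hg⟩ := (isShortExact_iff _ _).1 hs
  refine (isShortExact_iff _ _).2 ⟨fun a b hab => ?_, fun b => ⟨fun hb => ?_, ?_⟩, fun c => ?_⟩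
  · exact DFunLike.ext (F := BimodHom R V X) _ _ fun v =>
      hf (congrArg (fun l : BimodHom R V Y => l v) hab)
  · exact exists_comp_eq_of_exact hf hfg (b : V →ₗ[Rᵐᵒᵖ] Y)
      fun v => congrArg (fun l : BimodHom R V Z => l v) hb
  · rintro ⟨a, rfl⟩
    exact DFunLike.ext (F := BimodHom R V Z) _ _ fun v => hfg.apply_apply_eq_zero _
  · obtain ⟨l, hl⟩ := h.lift hs (ModuleCat.ofHom (c : V →ₗ[Rᵐᵒᵖ] Z))
    exact ⟨l.hom, congrArg ModuleCat.Hom.hom hl⟩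

variable (V) in
/-- Every module in `Q` is a quotient of a power of `V` with kernel in `Q`, and `V` is Ext-projective
with respect to `Q`. -/
structure IsPowGenerated (Q : ObjectProperty (ModuleCat.{u} Rᵐᵒᵖ)) : Prop where
  generates : ∀ Y : ModuleCat.{u} Rᵐᵒᵖ, Q Y → ∃ (n : ℕ) (π : (Fin n → V) →ₗ[Rᵐᵒᵖ] Y),
    Function.Surjective π ∧ Q (ModuleCat.of Rᵐᵒᵖ (LinearMap.ker π))
  ext_vanishes : ∀ Y : ModuleCat.{u} Rᵐᵒᵖ, Q Y → ExtVanishes (ModuleCat.of Rᵐᵒᵖ V) Y 1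

variable {Q : ObjectProperty (ModuleCat.{u} Rᵐᵒᵖ)}

/-- Generation is used twice. The second kernel is again in `Q`, so maps from any module
Ext-orthogonal to `Q` into the first kernel lift to `Vᵐ`. -/
theorem IsPowGenerated.exists_presentation (hQ : IsPowGenerated V Q) {Y : ModuleCat.{u} Rᵐᵒᵖ}
    (hY : Q Y) : ∃ (n : ℕ) (π : (Fin n → V) →ₗ[Rᵐᵒᵖ] Y), Function.Surjective π ∧
      Q (ModuleCat.of Rᵐᵒᵖ (LinearMap.ker π)) ∧
      ∃ (m : ℕ) (p : (Fin m → V) →ₗ[Rᵐᵒᵖ] (Fin n → V)), Function.Exact p π ∧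
        ∀ N : ModuleCat.{u} Rᵐᵒᵖ, (∀ Z : ModuleCat.{u} Rᵐᵒᵖ, Q Z → ExtVanishes N Z 1) →
          ∀ g : N →ₗ[Rᵐᵒᵖ] (Fin n → V), π ∘ₗ g = 0 → ∃ b, g = p ∘ₗ b := by
  obtain ⟨n, π, hπ, hker⟩ := hQ.generates Y hY
  obtain ⟨m, p, hp, hker'⟩ := hQ.generates _ hker
  refine ⟨n, π, hπ, hker, m, (LinearMap.ker π).subtype ∘ₗ p, fun v => ⟨fun hv => ?_, ?_⟩,
    fun N hN g hg => ?_⟩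
  · obtain ⟨w, hw⟩ := hp ⟨v, hv⟩
    exact ⟨w, congrArg Subtype.val hw⟩
  · rintro ⟨w, rfl⟩
    exact (p w).2
  · obtain ⟨b, hb⟩ := (hN _ hker').exists_lift hp
      (g.codRestrict (LinearMap.ker π) fun x =>
        congrArg (fun l : N →ₗ[Rᵐᵒᵖ] Y => l x) hg)
    exact ⟨b, LinearMap.ext fun x => congrArg (fun l => ((l x : LinearMap.ker π) : Fin n → V)) hb.symm⟩

theorem IsPowGenerated.isIso_counit (hQ : IsPowGenerated V Q) (hS : IsBalancedBimodule S R V)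
    {Y : ModuleCat.{u} Rᵐᵒᵖ} (hY : Q Y) : IsIso ((BimodTensor.adjunction S R V).counit.app Y) := by
  obtain ⟨n, π, hπ, hker, m, p, hp, -⟩ := hQ.exists_presentation hY
  rw [ConcreteCategory.isIso_iff_bijective]
  exact bijective_counit hS π hπ ((hQ.ext_vanishes _ hker).exists_lift hπ) p hp

theorem IsPowGenerated.finite_hom (hQ : IsPowGenerated V Q) (hS : IsBalancedBimodule S R V)
    {Y : ModuleCat.{u} Rᵐᵒᵖ} (hY : Q Y) : Module.Finite Sᵐᵒᵖ (BimodHom R V Y) := by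
  obtain ⟨n, π, hπ, hker⟩ := hQ.generates Y hY
  have := hS.finite_pow n
  exact Module.Finite.of_surjective (BimodHom.map S R V π)
    ((hQ.ext_vanishes _ hker).exists_lift hπ)

variable [CommRing k] [Algebra k R] [Module k V] [IsScalarTower k Rᵐᵒᵖ V]
  {N : Type u} [AddCommGroup N] [Module Rᵐᵒᵖ N] {M : Type u} [AddCommGroup M] [Module Sᵐᵒᵖ M]

theorem IsPowGenerated.exists_functional (hQ : IsPowGenerated V Q) (hS : IsBalancedBimodule S R V)
    (hN : ∀ Z : ModuleCat.{u} Rᵐᵒᵖ, Q Z → ExtVanishes (ModuleCat.of Rᵐᵒᵖ N) Z 1)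
    (ev : M →+ ((N →ₗ[Rᵐᵒᵖ] V) →ₗ[k] dualizingModule k))
    (hev : ∀ m (s : S) g, ev (MulOpposite.op s • m) g =
      ev m (DistribSMul.toLinearMap Rᵐᵒᵖ V s ∘ₗ g))
    {Y : Type u} [AddCommGroup Y] [Module Rᵐᵒᵖ Y] [Module k Y] [IsScalarTower k Rᵐᵒᵖ Y]
    (hY : Q (ModuleCat.of Rᵐᵒᵖ Y)) (ψ : BimodHom R V Y →ₗ[Sᵐᵒᵖ] M) :
    ∃ φ : (N →ₗ[Rᵐᵒᵖ] Y) →ₗ[k] dualizingModule k,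
      ∀ (f : V →ₗ[Rᵐᵒᵖ] Y) (g : N →ₗ[Rᵐᵒᵖ] V), ev (ψ f) g = φ (f ∘ₗ g) := by
  obtain ⟨n, π, hπ, hker, m, p, hp, hlift⟩ := hQ.exists_presentation hY
  refine exists_functional_of_pairing hS π ((hQ.ext_vanishes _ hker).exists_lift hπ)
    ((hN _ hker).exists_lift hπ) (fun g hg => ?_) ψ ev hev
  obtain ⟨b, hb⟩ := hlift (ModuleCat.of Rᵐᵒᵖ N) hN g hg
  exact ⟨m, p, b, LinearMap.ext hp.apply_apply_eq_zero, hb⟩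

/-- `Ext¹_S(Hom_R(V, Y), M) = 0` for `Y` in `Q`, if `M` is the dual of `Hom_R(N, V)` for a module
`N` with `Ext¹_R(N, Q) = 0`. -/
theorem IsPowGenerated.extVanishes_hom (hQ : IsPowGenerated V Q) (hS : IsBalancedBimodule S R V)
    (hN : ∀ Z : ModuleCat.{u} Rᵐᵒᵖ, Q Z → ExtVanishes (ModuleCat.of Rᵐᵒᵖ N) Z 1)
    (ev : M →+ ((N →ₗ[Rᵐᵒᵖ] V) →ₗ[k] dualizingModule k)) (hbij : Function.Bijective ev)
    (hev : ∀ m (s : S) g, ev (MulOpposite.op s • m) g =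
      ev m (DistribSMul.toLinearMap Rᵐᵒᵖ V s ∘ₗ g))
    {Y : ModuleCat.{u} Rᵐᵒᵖ} (hY : Q Y) :
    ExtVanishes ((homFunctor S R V).obj Y) (ModuleCat.of Sᵐᵒᵖ M) 1 := by
  obtain ⟨n, π, hπ, hker⟩ := hQ.generates Y hY
  have hs := (hQ.ext_vanishes _ hker).isShortExact_homFunctor S (isShortExact_ker hπ)
  -- The middle term `Hom(V, Vⁿ) ≅ Sⁿ` is projective, so it remains to extend maps `Hom(V, ker π) →
  -- M`; through `ev` these become functionals on `Hom(N, ker π)`.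
  refine extVanishes_of_forall_extend hs (extVanishes_of_projective (hS.projective_pow n))
    fun ψ => ?_
  let := moduleOfAlgebra k Rᵐᵒᵖ (LinearMap.ker π)
  have := isScalarTower_moduleOfAlgebra k Rᵐᵒᵖ (LinearMap.ker π)
  obtain ⟨φ, hφ⟩ := hQ.exists_functional hS hN ev hev hker ψ.hom
  obtain ⟨ψ', hψ'⟩ := exists_extend_of_functional ψ.hom ev hbij hev φ hφ
    (LinearMap.ker π).subtype (Submodule.subtype_injective _)
  exact ⟨ModuleCat.ofHom ψ', ModuleCat.hom_ext (LinearMap.ext hψ')⟩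

end Generated

/-! ### The functor `- ⊗_R DT` -/

section TensorFinite

variable {S R V M : Type u} [Ring S] [Ring R] [AddCommGroup V] [Module S V] [Module Rᵐᵒᵖ V]
  [SMulCommClass S Rᵐᵒᵖ V] [AddCommGroup M] [Module Sᵐᵒᵖ M]

variable (S R V) in
/-- The map `v ↦ m ⊗ v`. -/
def BimodTensor.mk (m : M) : V →ₗ[Rᵐᵒᵖ] BimodTensor S V M where
  toFun v := tmul S V m v
  map_add' := tmul_add S V m
  map_smul' _ _ := rfl

theorem BimodTensor.finite [Module.Finite Rᵐᵒᵖ V] [Module.Finite Sᵐᵒᵖ M] :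
    Module.Finite Rᵐᵒᵖ (BimodTensor S V M) := by
  obtain ⟨n, p, hp⟩ := Module.Finite.exists_fin' Sᵐᵒᵖ M
  let f : (Fin n → V) →ₗ[Rᵐᵒᵖ] BimodTensor S V M :=
    ∑ j, BimodTensor.mk S R V (p (Pi.single j 1)) ∘ₗ LinearMap.proj j
  have hf (v : Fin n → V) : f v = ∑ j, tmul S V (p (Pi.single j 1)) (v j) :=
    LinearMap.sum_apply _ _ _
  refine Module.Finite.of_surjective f fun z => ?_
  induction z using BimodTensor.induction with
  | zero => exact ⟨0, map_zero f⟩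
  | tmul m v =>
    obtain ⟨c, rfl⟩ := hp m
    refine ⟨fun j => (c j).unop • v, ?_⟩
    rw [hf, map_eq_sum_single, sum_tmul]
    refine Finset.sum_congr rfl fun j _ => ?_
    have : (Pi.single j (c j) : Fin n → Sᵐᵒᵖ) = c j • Pi.single j 1 := by
      rw [← Pi.single_smul, smul_eq_mul, mul_one]
    rw [this, map_smul, ← smul_tmul, MulOpposite.op_unop]
  | add a b ha hb =>
    obtain ⟨v, rfl⟩ := ha
    obtain ⟨w, rfl⟩ := hb
    exact ⟨v + w, map_add f v w⟩

end TensorFinite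

section DualBimodule

variable {k S R T : Type u} [CommRing k] [Ring S] [Ring R] [Algebra k S] [Algebra k R]
  [AddCommGroup T] [Module k T] [Module S T] [Module Rᵐᵒᵖ T] [SMulCommClass S Rᵐᵒᵖ T]
  [IsScalarTower k S T] [IsScalarTower k Rᵐᵒᵖ T]

variable (k S R T) in
/-- `Hom_R(T, DR) = DT`. -/
def homArtinDualEquiv : BimodHom R T (ArtinDual k R) ≃ₗ[Sᵐᵒᵖ] ArtinDual k T where
  toFun f := evalOne (f : T →ₗ[Rᵐᵒᵖ] ArtinDual k R)
  invFun d := toArtinDual (d : T →ₗ[k] dualizingModule k)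
  map_add' _ _ := rfl
  map_smul' _ _ := rfl
  left_inv f := DFunLike.ext _ _ fun t => DFunLike.ext _ _ fun r => by
    change f (MulOpposite.op r • t) (1 : R) = f t r
    rw [ArtinDual.apply_eq_smul_one (f t)]
    exact congrArg (fun d : ArtinDual k R => d (1 : R))
      (LinearMap.map_smul (f : T →ₗ[Rᵐᵒᵖ] ArtinDual k R) _ t)
  right_inv d := evalOne_toArtinDual _

theorem homArtinDualEquiv_symm_apply (d : ArtinDual k T) (t : T) (r : R) :
    ((homArtinDualEquiv k S R T).symm d) t r = d (MulOpposite.op r • t) := rfl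

variable (k S R T) in
/-- `Hom_R(T, (DR)ⁿ) = (DT)ⁿ`. -/
def homPowArtinDualEquiv (n : ℕ) :
    BimodHom R T (Fin n → ArtinDual k R) ≃ₗ[Sᵐᵒᵖ] (Fin n → ArtinDual k T) where
  toFun f := fun j => homArtinDualEquiv k S R T (BimodHom.map S R T (LinearMap.proj j) f)
  invFun d := LinearMap.pi fun j =>
    ((homArtinDualEquiv k S R T).symm (d j) : T →ₗ[Rᵐᵒᵖ] ArtinDual k R)
  map_add' f g := funext fun j => by
    rw [map_add, map_add]; rfl
  map_smul' s f := funext fun j => by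
    rw [map_smul, map_smul]; rfl
  left_inv f := DFunLike.ext (F := BimodHom R T (Fin n → ArtinDual k R)) _ _ fun t =>
    funext fun j => congrArg (fun l : BimodHom R T (ArtinDual k R) => l t)
      ((homArtinDualEquiv k S R T).symm_apply_apply (BimodHom.map S R T
        (LinearMap.proj (φ := fun _ => ArtinDual k R) j) f))
  right_inv d := funext fun j => (homArtinDualEquiv k S R T).apply_symm_apply (d j)

/-- `DT = D Hom_R(R, T)`. -/
def evalRegular : ArtinDual k T →+ ((Rᵐᵒᵖ →ₗ[Rᵐᵒᵖ] T) →ₗ[k] dualizingModule k) where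
  toFun d := (d : T →ₗ[k] dualizingModule k) ∘ₗ
    { toFun := fun g => g 1
      map_add' := fun _ _ => rfl
      map_smul' := fun _ _ => rfl }
  map_zero' := rfl
  map_add' _ _ := rfl

theorem bijective_evalRegular :
    Function.Bijective (evalRegular : ArtinDual k T →+ ((Rᵐᵒᵖ →ₗ[Rᵐᵒᵖ] T) →ₗ[k] _)) := by
  have h1 (t : T) : LinearMap.toSpanSingleton Rᵐᵒᵖ T t 1 = t := one_smul _ t
  refine ⟨fun d d' h => DFunLike.ext _ _ fun t => ?_, fun χ => ?_⟩
  · have h2 := congrArg (fun l => l (LinearMap.toSpanSingleton Rᵐᵒᵖ T t)) h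
    change d (LinearMap.toSpanSingleton Rᵐᵒᵖ T t 1) = d' (LinearMap.toSpanSingleton Rᵐᵒᵖ T t 1) at h2
    rwa [h1] at h2
  · refine ⟨(χ ∘ₗ
      { toFun := fun t => LinearMap.toSpanSingleton Rᵐᵒᵖ T t
        map_add' := fun t t' => LinearMap.ext fun r => smul_add r t t'
        map_smul' := fun c t => LinearMap.ext fun r => smul_comm r c t } :
        T →ₗ[k] dualizingModule k), LinearMap.ext fun g => ?_⟩
    change χ (LinearMap.toSpanSingleton Rᵐᵒᵖ T (g 1)) = χ g
    congr 1
    exact LinearMap.ext_ring (h1 _)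

variable {X : Type u} [AddCommGroup X] [Module Rᵐᵒᵖ X]

/-- The map `X ⊗_R DT → D Hom_R(X, T)`. -/
def evalTensor : BimodTensor R (ArtinDual k T) X →+ ((X →ₗ[Rᵐᵒᵖ] T) →ₗ[k] dualizingModule k) :=
  BimodTensor.lift
    (AddMonoidHom.mk' (fun x => AddMonoidHom.mk' (fun d => (
        { toFun := fun g => d (g x)
          map_add' := fun g g' => map_add d (g x) (g' x)
          map_smul' := fun c g => LinearMap.map_smul (d : T →ₗ[k] dualizingModule k) c (g x) } :
        (X →ₗ[Rᵐᵒᵖ] T) →ₗ[k] dualizingModule k)) fun _ _ => rfl)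
      fun x y => AddMonoidHom.ext fun d => LinearMap.ext fun g =>
        (congrArg d (map_add g x y)).trans (map_add d _ _))
    fun r x d => LinearMap.ext fun g => congrArg d (map_smul g (MulOpposite.op r) x)

theorem evalTensor_tmul (x : X) (d : ArtinDual k T) (g : X →ₗ[Rᵐᵒᵖ] T) :
    evalTensor (BimodTensor.tmul R (ArtinDual k T) x d) g = d (g x) := rfl

theorem evalTensor_smul (z : BimodTensor R (ArtinDual k T) X) (s : S) (g : X →ₗ[Rᵐᵒᵖ] T) :
    evalTensor (MulOpposite.op s • z) g = evalTensor z (DistribSMul.toLinearMap Rᵐᵒᵖ T s ∘ₗ g) := by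
  induction z using BimodTensor.induction with
  | zero => rw [smul_zero, map_zero]; rfl
  | tmul x d => rfl
  | add a b ha hb => rw [smul_add, map_add, map_add, LinearMap.add_apply, LinearMap.add_apply, ha, hb]

variable [IsArtinianRing k] [Module.Finite k T]

-- Tensor-hom adjunction and reflexivity of `T` identify `Hom_R(X, T)` with the dual of `X ⊗ DT`.
-- Dualizing once more gives the claim, as `X ⊗ DT` is finitely generated over `k`, hence reflexive.
variable (S) in
theorem bijective_evalTensor [Module.Finite k R] [Module.Finite Rᵐᵒᵖ X] [Module.Finite k S] :
    Function.Bijective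
      (evalTensor : BimodTensor R (ArtinDual k T) X →+ ((X →ₗ[Rᵐᵒᵖ] T) →ₗ[k] _)) := by
  have : Module.Finite Sᵐᵒᵖ (ArtinDual k T) := Module.Finite.of_restrictScalars_finite k Sᵐᵒᵖ _
  have : Module.Finite Sᵐᵒᵖ (BimodTensor R (ArtinDual k T) X) := BimodTensor.finite
  let := moduleOfAlgebra k Sᵐᵒᵖ (BimodTensor R (ArtinDual k T) X)
  have := isScalarTower_moduleOfAlgebra k Sᵐᵒᵖ (BimodTensor R (ArtinDual k T) X)
  have : Module.Finite k (BimodTensor R (ArtinDual k T) X) := Module.Finite.trans Sᵐᵒᵖ _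
  have hsmul (c : k) (x : X) (d : ArtinDual k T) : c • BimodTensor.tmul R (ArtinDual k T) x d =
      BimodTensor.tmul R (ArtinDual k T) x (c • d) := by
    rw [← algebraMap_smul Sᵐᵒᵖ c d]; rfl
  have hlin (c : k) (z : BimodTensor R (ArtinDual k T) X) (g : X →ₗ[Rᵐᵒᵖ] T) :
      evalTensor (c • z) g = c • evalTensor z g := by
    induction z using BimodTensor.induction with
    | zero => rw [smul_zero, map_zero, LinearMap.zero_apply, smul_zero]
    | tmul x d => rw [hsmul]; rfl
    | add a b ha hb =>
      rw [smul_add, map_add, map_add, LinearMap.add_apply, LinearMap.add_apply, ha, hb, smul_add]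
  let Γ : (X →ₗ[Rᵐᵒᵖ] T) →ₗ[k] (BimodTensor R (ArtinDual k T) X →ₗ[k] dualizingModule k) :=
    { toFun := fun g =>
        { toFun := fun z => evalTensor z g
          map_add' := fun z w => by rw [map_add]; rfl
          map_smul' := fun c z => hlin c z g }
      map_add' := fun g g' => LinearMap.ext fun z => map_add (evalTensor z) g g'
      map_smul' := fun c g => LinearMap.ext fun z => map_smul (evalTensor z) c g }
  have hΓ : Function.Bijective Γ := by
    refine ⟨fun g g' h => LinearMap.ext fun x => dual_eval_injective (k := k) fun d => ?_,
      fun ζ => ?_⟩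
    · exact congrArg (fun l => l (BimodTensor.tmul R (ArtinDual k T) x d)) h
    -- For fixed `x` the functional `d ↦ ζ (x ⊗ d)` on `DT` is evaluation at an element of `T`; as
    -- `x` varies these elements form the map corresponding to `ζ`.
    choose t ht using fun x : X => exists_eq_dual_eval (k := k) (M := T)
      { toFun := fun d => ζ (BimodTensor.tmul R (ArtinDual k T) x d)
        map_add' := fun d d' => by
          rw [← map_add]
          exact congrArg ζ (BimodTensor.tmul_add R (ArtinDual k T) x d d')
        map_smul' := fun c d => by
          exact (congrArg ζ (hsmul c x d).symm).trans (map_smul ζ c _) }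
    have ht' (x : X) (d : ArtinDual k T) :
        ζ (BimodTensor.tmul R (ArtinDual k T) x d) = d (t x) := ht x d
    refine ⟨⟨⟨t, fun x y => ?_⟩, fun r x => ?_⟩, LinearMap.ext fun z => ?_⟩
    · refine dual_eval_injective (k := k) fun d => ?_
      rw [map_add]
      refine (ht' _ d).symm.trans ?_
      exact (congrArg ζ (BimodTensor.add_tmul (V := ArtinDual k T) x y d)).trans
        ((map_add ζ _ _).trans (congrArg₂ (· + ·) (ht' x d) (ht' y d)))
    · refine dual_eval_injective (k := k) fun d => ?_
      refine (ht' _ d).symm.trans ?_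
      have h1 := BimodTensor.smul_tmul (V := ArtinDual k T) r.unop x d
      rw [MulOpposite.op_unop] at h1
      rw [h1, ht']; rfl
    · induction z using BimodTensor.induction with
      | zero => rw [map_zero, map_zero]
      | tmul x d => exact (ht' x d).symm
      | add a b ha hb => rw [map_add, map_add, ha, hb]
  refine ⟨(injective_iff_map_eq_zero _).2 fun z hz => ?_, fun χ => ?_⟩
  · refine dual_eval_injective (k := k) fun ζ => ?_
    obtain ⟨g, rfl⟩ := hΓ.2 ζ
    rw [map_zero]
    exact congrArg (fun l => l g) hz
  · obtain ⟨z, hz⟩ := exists_eq_dual_eval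
      (χ ∘ₗ (LinearEquiv.ofBijective Γ hΓ).symm.toLinearMap)
    refine ⟨z, LinearMap.ext fun g => ?_⟩
    have h1 := hz (Γ g)
    rw [LinearMap.comp_apply] at h1
    have h2 : (LinearEquiv.ofBijective Γ hΓ).symm.toLinearMap (Γ g) = g :=
      (LinearEquiv.ofBijective Γ hΓ).symm_apply_apply g
    rw [h2] at h1
    exact h1.symm

end DualBimodule

/-! ### The dual of a balanced bimodule -/

section DualBalanced

variable {k S R T : Type u} [CommRing k] [Ring S] [Ring R] [Algebra k S] [Algebra k R]
  [AddCommGroup T] [Module k T] [Module S T] [Module Rᵐᵒᵖ T] [SMulCommClass S Rᵐᵒᵖ T]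
  [IsScalarTower k S T] [IsScalarTower k Rᵐᵒᵖ T]

/-- If `R` acts as the endomorphism ring of `_S T`, then also as that of `DT_S`. -/
theorem isBalancedBimodule_artinDual [IsArtinianRing k] [Module.Finite k T]
    (hT : Function.Bijective fun r : Rᵐᵒᵖ => BimodTensor.rightMul S R T r) :
    IsBalancedBimodule R S (ArtinDual k T) := by
  refine ⟨fun r r' h => MulOpposite.op_injective (hT.1 (LinearMap.ext fun t =>
    dual_eval_injective (k := k) fun d => ?_)), fun f => ?_⟩
  · exact congrArg (fun l : ArtinDual k T →ₗ[Sᵐᵒᵖ] ArtinDual k T => l d t) h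
  -- By reflexivity `f` is the transpose of an `S`-endomorphism `t'` of `T`, which is right
  -- multiplication by an element of `R`.
  · choose t' ht using fun t : T => exists_eq_dual_eval (k := k) (M := T)
      { toFun := fun d => f d t
        map_add' := fun d d' => congrArg (fun l : ArtinDual k T => l t) (map_add f d d')
        map_smul' := fun c d => congrArg (fun l : ArtinDual k T => l t)
          (LinearMap.map_smul_of_tower f c (d : ArtinDual k T)) }
    have ht' (t : T) (d : ArtinDual k T) : f d t = d (t' t) := ht t d
    obtain ⟨r, hr⟩ := hT.2
      { toFun := t'
        map_add' := fun t s => dual_eval_injective (k := k) fun d =>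
          (ht' _ d).symm.trans ((map_add (f d) t s).trans
            ((congrArg₂ (· + ·) (ht' t d) (ht' s d)).trans (map_add d _ _).symm))
        map_smul' := fun s t => dual_eval_injective (k := k) fun (d : ArtinDual k T) => by
          refine (ht' _ d).symm.trans ?_
          have h1 := ht' t (MulOpposite.op s • d)
          rw [map_smul] at h1
          exact h1 }
    refine ⟨r.unop, LinearMap.ext fun d => DFunLike.ext _ _ fun t => ?_⟩
    rw [ht']
    exact congrArg (fun l => d (l t)) hr

variable {A : Type u} [AddCommGroup A] [Module Rᵐᵒᵖ A] [Module k A] [IsScalarTower k Rᵐᵒᵖ A]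

variable (k S R T A) in
/-- The map `DA → Hom_S(Hom_R(T, A), DT)`. -/
def dualHomMap : (A →ₗ[k] dualizingModule k) →ₗ[k] (BimodHom R T A →ₗ[Sᵐᵒᵖ] ArtinDual k T) where
  toFun ξ :=
    { toFun := fun h => (ξ ∘ₗ (h : T →ₗ[Rᵐᵒᵖ] A).restrictScalars k : T →ₗ[k] dualizingModule k)
      map_add' := fun h h' => DFunLike.ext _ _ fun t => map_add ξ (h t) (h' t)
      map_smul' := fun _ _ => rfl }
  map_add' _ _ := rfl
  map_smul' _ _ := rfl

theorem dualHomMap_apply (ξ : A →ₗ[k] dualizingModule k) (h : BimodHom R T A) (t : T) :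
    dualHomMap k S R T A ξ h t = ξ (h t) := rfl

/-- The isomorphism `Hom(T, A) ⊗ T ≅ A` gives injectivity, as `A` is generated by the values `h t`.
Conversely, a map `Hom(T, A) → DT = Hom(T, DR)` corresponds by adjunction to a map `A → DR`, that
is, to a functional on `A`. -/
theorem bijective_dualHomMap
    (hA : Function.Bijective (BimodTensor.uncurry S R T
      (LinearMap.id : BimodHom R T A →ₗ[Sᵐᵒᵖ] BimodHom R T A))) :
    Function.Bijective (dualHomMap k S R T A) := by
  let ε := LinearEquiv.ofBijective _ hA
  have hε (h : BimodHom R T A) (t : T) : ε.symm (h t) = BimodTensor.tmul S T h t :=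
    ε.symm_apply_apply (BimodTensor.tmul S T h t)
  refine ⟨fun ξ ξ' h => LinearMap.ext fun a => ?_, fun f => ?_⟩
  · obtain ⟨z, rfl⟩ := hA.2 a
    induction z using BimodTensor.induction with
    | zero => rw [map_zero, map_zero, map_zero]
    | tmul g t => exact congrArg (fun l => l g t) h
    | add a b ha hb => rw [map_add, map_add, map_add, ha, hb]
  · let a : A →ₗ[Rᵐᵒᵖ] ArtinDual k R := BimodTensor.uncurry S R T
      ((homArtinDualEquiv k S R T).symm.toLinearMap ∘ₗ f) ∘ₗ ε.symm.toLinearMap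
    refine ⟨evalOne a, LinearMap.ext fun h => DFunLike.ext _ _ fun t => ?_⟩
    rw [dualHomMap_apply, evalOne_apply]
    have h1 : a (h t) = (homArtinDualEquiv k S R T).symm (f h) t := by
      change BimodTensor.uncurry S R T _ (ε.symm (h t)) = _
      rw [hε]; rfl
    rw [h1, homArtinDualEquiv_symm_apply, MulOpposite.op_one, one_smul]

/-- `A = D Hom_S(Hom_R(T, A), DT)`. -/
theorem exists_eval_hom [IsArtinianRing k] [Module.Finite k A]
    (hA : Function.Bijective (BimodTensor.uncurry S R T
      (LinearMap.id : BimodHom R T A →ₗ[Sᵐᵒᵖ] BimodHom R T A))) :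
    ∃ ev : A →+ ((BimodHom R T A →ₗ[Sᵐᵒᵖ] ArtinDual k T) →ₗ[k] dualizingModule k),
      Function.Bijective ev ∧ ∀ a (r : R) g, ev (MulOpposite.op r • a) g =
        ev a (DistribSMul.toLinearMap Sᵐᵒᵖ (ArtinDual k T) r ∘ₗ g) := by
  let Ψ := LinearEquiv.ofBijective _ (bijective_dualHomMap (k := k) hA)
  have hΨ (ξ) : Ψ.symm (dualHomMap k S R T A ξ) = ξ := Ψ.symm_apply_apply ξ
  refine ⟨AddMonoidHom.mk' (fun a => LinearMap.applyₗ a ∘ₗ Ψ.symm.toLinearMap)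
    fun a b => LinearMap.ext fun g => map_add (Ψ.symm g) a b, ⟨fun a b h => ?_, fun χ => ?_⟩,
    fun a r g => ?_⟩
  · refine dual_eval_injective (k := k) fun ξ => ?_
    have h1 : Ψ.symm (dualHomMap k S R T A ξ) a = Ψ.symm (dualHomMap k S R T A ξ) b :=
      congrArg (fun l => l (dualHomMap k S R T A ξ)) h
    rwa [hΨ] at h1
  · obtain ⟨a, ha⟩ := exists_eq_dual_eval (χ ∘ₗ dualHomMap k S R T A)
    refine ⟨a, LinearMap.ext fun g => ?_⟩
    obtain ⟨ξ, rfl⟩ := (bijective_dualHomMap (k := k) hA).2 g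
    change Ψ.symm (dualHomMap k S R T A ξ) a = _
    rw [hΨ, ← ha]; rfl
  · obtain ⟨ξ, rfl⟩ := (bijective_dualHomMap (k := k) hA).2 g
    change Ψ.symm (dualHomMap k S R T A ξ) _ = Ψ.symm _ a
    have h1 : DistribSMul.toLinearMap Sᵐᵒᵖ (ArtinDual k T) r ∘ₗ dualHomMap k S R T A ξ =
        dualHomMap k S R T A (ξ ∘ₗ DistribSMul.toLinearMap k A (MulOpposite.op r)) :=
      LinearMap.ext fun h => DFunLike.ext _ _ fun t =>
        congrArg ξ (LinearMap.map_smul (h : T →ₗ[Rᵐᵒᵖ] A) _ t)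
    rw [h1, hΨ, hΨ]; rfl

/-- The unit of the adjunction given by `DT` is an isomorphism on the modules `X` that are
cogenerated by `T` and Ext-orthogonal to a class generated by `T` that contains `DR`. -/
theorem bijective_unit_artinDual [IsArtinianRing k] [Module.Finite k T] [Module.Finite k R]
    [Module.Finite k S] {Q : ObjectProperty (ModuleCat.{u} Rᵐᵒᵖ)} (hQ : IsPowGenerated T Q)
    (hS : IsBalancedBimodule S R T) (hQR : Q (ModuleCat.of Rᵐᵒᵖ (ArtinDual k R)))
    {X : Type u} [AddCommGroup X] [Module Rᵐᵒᵖ X] [Module.Finite Rᵐᵒᵖ X]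
    (hX : ∀ Z : ModuleCat.{u} Rᵐᵒᵖ, Q Z → ExtVanishes (ModuleCat.of Rᵐᵒᵖ X) Z 1)
    {n : ℕ} (i : X →ₗ[Rᵐᵒᵖ] (Fin n → T)) (hi : Function.Injective i) :
    Function.Bijective (BimodTensor.curry R S (ArtinDual k T)
      (LinearMap.id : BimodTensor R (ArtinDual k T) X →ₗ[Sᵐᵒᵖ] BimodTensor R (ArtinDual k T) X)) := by
  have hev := bijective_evalTensor (k := k) (R := R) (T := T) (X := X) S
  refine ⟨(injective_iff_map_eq_zero _).2 fun x hx => hi ?_, fun y => ?_⟩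
  · rw [map_zero]
    -- If all `x ⊗ d` vanish, pairing them with the coordinates of the embedding `i` shows that
    -- every functional kills every coordinate of `i x`.
    refine funext fun j => dual_eval_injective (k := k) fun d => ?_
    rw [Pi.zero_apply, map_zero]
    have h1 : BimodTensor.tmul R (ArtinDual k T) x d = 0 :=
      congrArg (fun l : BimodHom S (ArtinDual k T) (BimodTensor R (ArtinDual k T) X) => l d) hx
    have h2 := evalTensor_tmul (k := k) x d (LinearMap.proj j ∘ₗ i)
    rw [h1, map_zero] at h2
    exact h2.symm
  -- Read through `Hom(T, DR) = DT` and `X ⊗ DT = D Hom(X, T)`, the map `y` comes from a functional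
  -- on `Hom(X, DR) = DX`, which by reflexivity is evaluation at an element `x` of `X`.
  · let ψ : BimodHom R T (ArtinDual k R) →ₗ[Sᵐᵒᵖ] BimodTensor R (ArtinDual k T) X :=
      LinearMap.comp (y : ArtinDual k T →ₗ[Sᵐᵒᵖ] BimodTensor R (ArtinDual k T) X)
        (homArtinDualEquiv k S R T).toLinearMap
    let := moduleOfAlgebra k Rᵐᵒᵖ X
    have := isScalarTower_moduleOfAlgebra k Rᵐᵒᵖ X
    have : Module.Finite k X := Module.Finite.trans Rᵐᵒᵖ X
    obtain ⟨φ, hφ⟩ := hQ.exists_functional hS hX evalTensor evalTensor_smul hQR ψ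
    obtain ⟨x, hx⟩ := exists_eq_dual_eval (k := k) (M := X)
      (φ ∘ₗ
        { toFun := fun ξ => toArtinDual (R := R) ξ
          map_add' := fun _ _ => rfl
          map_smul' := fun _ _ => rfl })
    refine ⟨x, DFunLike.ext (F := BimodHom S (ArtinDual k T) (BimodTensor R (ArtinDual k T) X)) _ _
      fun d => hev.1 (LinearMap.ext fun g => ?_)⟩
    have h1 := hφ ((homArtinDualEquiv k S R T).symm d : BimodHom R T (ArtinDual k R)) g
    have h2 : ψ ((homArtinDualEquiv k S R T).symm d) = y d :=
      congrArg y ((homArtinDualEquiv k S R T).apply_symm_apply d)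
    have h3 := hx ((d : T →ₗ[k] dualizingModule k) ∘ₗ g.restrictScalars k)
    have h4 : toArtinDual (R := R) ((d : T →ₗ[k] dualizingModule k) ∘ₗ g.restrictScalars k) =
        LinearMap.comp ((homArtinDualEquiv k S R T).symm d : T →ₗ[Rᵐᵒᵖ] ArtinDual k R) g :=
      LinearMap.ext fun x => DFunLike.ext _ _ fun r =>
        congrArg d (map_smul g (MulOpposite.op r) x)
    change d (g x) = _
    rw [← h2]
    refine Eq.trans ?_ h1.symm
    refine h3.symm.trans ?_
    exact congrArg φ h4

end DualBalanced

/-! ### Good Wakamatsu-tilting modules -/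

section Main

theorem rightExtPerp_extension {A : Type u} [Ring A] {P : ObjectProperty (ModuleCat.{u} A)}
    {X Y Z : ModuleCat.{u} A} (f : X ⟶ Y) (g : Y ⟶ Z) (hs : IsShortExact f g)
    (hX : rightExtPerp P X) (hZ : rightExtPerp P Z) : rightExtPerp P Y :=
  ⟨Module.Finite.of_isShortExact hs hX.1 hZ.1,
    fun W hW => ExtVanishes.middle_right hs (hX.2 W hW) (hZ.2 W hW)⟩

theorem rightExtPerp_retract {A : Type u} [Ring A] {P : ObjectProperty (ModuleCat.{u} A)}
    {X Y : ModuleCat.{u} A} (r : Retract X Y) (hY : rightExtPerp P Y) : rightExtPerp P X :=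
  ⟨Module.Finite.of_retract r hY.1, fun W hW => (hY.2 W hW).retract_right r⟩

theorem finite_rightEnd (k R T : Type u) [CommRing k] [IsNoetherianRing k] [Ring R] [Algebra k R]
    [AddCommGroup T] [Module Rᵐᵒᵖ T] [Module k T] [IsScalarTower k Rᵐᵒᵖ T] [Module.Finite k T] :
    Module.Finite k (RightEnd R T) :=
  Module.Finite.of_injective (LinearMap.restrictScalarsₗ k Rᵐᵒᵖ T T k)
    (LinearMap.restrictScalars_injective k)

theorem isBalancedBimodule_rightEnd (R T : Type u) [Ring R] [AddCommGroup T] [Module Rᵐᵒᵖ T] :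
    IsBalancedBimodule (RightEnd R T) R T :=
  Function.bijective_id

theorem IsExtProjectiveGenerator.isPowGenerated {R T : Type u} [Ring R] [AddCommGroup T]
    [Module Rᵐᵒᵖ T] {P : ObjectProperty (ModuleCat.{u} Rᵐᵒᵖ)} (hP : IsCoresolving P)
    (hgen : IsExtProjectiveGenerator P (ModuleCat.of Rᵐᵒᵖ T)) : IsPowGenerated T P where
  generates Y hY := by
    obtain ⟨X', T', f, g, hX', hT', hs⟩ := hgen.generates Y hY
    exact exists_pow_precover hP.extension hP.summand hgen.mem hX' hT' hs
  ext_vanishes := hgen.ext_vanishes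

variable {k R T : Type u} [CommRing k] [IsArtinianRing k] [Ring R] [Algebra k R]
  [Module.Finite k R] [AddCommGroup T] [Module Rᵐᵒᵖ T] [Module k T] [IsScalarTower k Rᵐᵒᵖ T]
  {P : ObjectProperty (ModuleCat.{u} Rᵐᵒᵖ)} {G : ObjectProperty (ModuleCat.{u} (RightEnd R T)ᵐᵒᵖ)}

theorem InducesEquivalence.prop_obj {C D : Type*} [Category* C] [Category* D] {H : C ⥤ D}
    {P : ObjectProperty C} {Q : ObjectProperty D} (h : InducesEquivalence H P Q)
    (hQ : ∀ {X Y : D}, Retract X Y → Q Y → Q X) (X : C) (hX : P X) : Q (H.obj X) := by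
  obtain ⟨e, ⟨α⟩⟩ := h
  exact hQ (α.symm.app ⟨X, hX⟩).retract (e.functor.obj ⟨X, hX⟩).2

theorem InducesEquivalence.exists_iso {C D : Type*} [Category* C] [Category* D] {H : C ⥤ D}
    {P : ObjectProperty C} {Q : ObjectProperty D} (h : InducesEquivalence H P Q) (Y : D)
    (hY : Q Y) : ∃ X : C, P X ∧ Nonempty (Y ≅ H.obj X) := by
  obtain ⟨e, ⟨α⟩⟩ := h
  exact ⟨_, (e.inverse.obj ⟨Y, hY⟩).2,
    ⟨(Q.ι.mapIso (e.counitIso.app ⟨Y, hY⟩)).symm ≪≫ α.app (e.inverse.obj ⟨Y, hY⟩)⟩⟩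

/-- The triangle identity inverts the unit at `H.obj X`, and naturality carries this along `e`. -/
theorem isIso_unit_of_iso {C D : Type*} [Category* C] [Category* D] {L : C ⥤ D} {H : D ⥤ C}
    (adj : L ⊣ H) {X : D} (hX : IsIso (adj.counit.app X)) {Y : C} (e : Y ≅ H.obj X) :
    IsIso (adj.unit.app Y) := by
  have h1 : IsIso (adj.unit.app (H.obj X)) := by
    have h2 := adj.right_triangle_components X
    have : IsIso (adj.unit.app (H.obj X) ≫ H.map (adj.counit.app X)) := by
      rw [h2]; exact IsIso.id (H.obj X)
    exact IsIso.of_isIso_comp_right _ (H.map (adj.counit.app X))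
  have h2 := adj.unit.naturality e.hom
  have : IsIso (adj.unit.app Y ≫ (L ⋙ H).map e.hom) := by
    rw [← h2]
    exact IsIso.comp_isIso' inferInstance h1
  exact IsIso.of_isIso_comp_right _ ((L ⋙ H).map e.hom)

/-- The data of the theorem: an equivalence `Hom_R(T, -) : P ≌ G` for which `T` is an
Ext-projective generator of `P`. -/
structure IsWakamatsuEquivalence (P : ObjectProperty (ModuleCat.{u} Rᵐᵒᵖ))
    (G : ObjectProperty (ModuleCat.{u} (RightEnd R T)ᵐᵒᵖ)) : Prop where
  coresolving : IsCoresolving P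
  resolving : IsResolving G
  generated : IsPowGenerated T P
  equivalence : InducesEquivalence (homFunctor (RightEnd R T) R T) P G

theorem IsCoresolving.prop_pow_artinDual (hP : IsCoresolving P) (n : ℕ) :
    P (ModuleCat.of Rᵐᵒᵖ (Fin n → ArtinDual k R)) :=
  hP.injective _ ((ModuleCat.isFG_iff _).2 inferInstance)
    (Module.injective_object_of_injective_module _ _)

theorem IsCoresolving.prop_artinDual (hP : IsCoresolving P) :
    P (ModuleCat.of Rᵐᵒᵖ (ArtinDual k R)) :=
  hP.injective _ ((ModuleCat.isFG_iff _).2 inferInstance)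
    (Module.injective_object_of_injective_module _ _)

namespace IsWakamatsuEquivalence

variable (h : IsWakamatsuEquivalence P G)

include h

theorem prop_artinDual : G (ModuleCat.of (RightEnd R T)ᵐᵒᵖ (ArtinDual k T)) :=
  h.resolving.summand (retractOfEquiv (homArtinDualEquiv k (RightEnd R T) R T).symm)
    (h.equivalence.prop_obj h.resolving.summand _ h.coresolving.prop_artinDual)

-- Write `N ≅ Hom(T, X)` and embed `X` in a power of `DR`. The cokernel stays in `P`, so Hom(T, -)
-- yields a short exact sequence with `N` on the left, a power of `DT` in the middle and a module of
-- `G` on the right; it splits because `N` is right orthogonal to `G`.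
variable (k) in
theorem addClosure_of_mem {N : ModuleCat.{u} (RightEnd R T)ᵐᵒᵖ} (hG : G N)
    (hK : rightExtPerp G N) :
    addClosure (ModuleCat.of (RightEnd R T)ᵐᵒᵖ (ArtinDual k T)) N := by
  obtain ⟨X, hX, ⟨e⟩⟩ := h.equivalence.exists_iso N hG
  have : Module.Finite Rᵐᵒᵖ X := h.coresolving.le_fg _ hX
  obtain ⟨n, i, hi⟩ := exists_embedding_artinDual (k := k) (R := R) X
  have hs := isShortExact_range hi
  have hC := h.coresolving.cokernel _ _ hs hX (h.coresolving.prop_pow_artinDual n)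
  have hs' := (h.generated.ext_vanishes _ hX).isShortExact_homFunctor (RightEnd R T) hs
  have hext := (hK.2 _ (h.equivalence.prop_obj h.resolving.summand _ hC)).retract_right
    e.symm.retract
  obtain ⟨r⟩ := hext.nonempty_retract_left hs'
  exact ⟨n, ⟨e.retract.trans (r.trans
    (retractOfEquiv (homPowArtinDualEquiv k (RightEnd R T) R T n)))⟩⟩

/-- The Ext-vanishing lemma with `N` the regular module, since `DT = D Hom_R(R, T)`. -/
theorem rightExtPerp_artinDual :
    rightExtPerp G (ModuleCat.of (RightEnd R T)ᵐᵒᵖ (ArtinDual k T)) := by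
  refine ⟨h.resolving.le_fg _ h.prop_artinDual, fun N hN => ?_⟩
  obtain ⟨X, hX, ⟨e⟩⟩ := h.equivalence.exists_iso N hN
  refine ExtVanishes.retract_left e.retract ?_
  exact h.generated.extVanishes_hom (isBalancedBimodule_rightEnd R T) (N := Rᵐᵒᵖ)
    (fun Z _ => extVanishes_of_projective ((IsProjective.iff_projective _).1 inferInstance))
    evalRegular bijective_evalRegular (fun _ _ _ => rfl) hX

/-- In a special `G`-precover of a module of the right perpendicular class, the middle term is in
both classes, hence in add DT. -/
theorem isPowGenerated_artinDual [Module.Finite k T]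
    (hcot : IsCompleteHereditaryCotorsionPair G (rightExtPerp G)) :
    IsPowGenerated (ArtinDual k T) (rightExtPerp G) where
  generates Y hY := by
    obtain ⟨Y', Z, f, g, hY', hZ, hs⟩ := hcot.complete_left Y hY.1
    have hZ' := rightExtPerp_extension f g hs hY' hY
    exact exists_pow_precover rightExtPerp_extension rightExtPerp_retract
      h.rightExtPerp_artinDual hY' (h.addClosure_of_mem k hZ hZ') hs
  ext_vanishes Y hY := hY.2 _ h.prop_artinDual

theorem induceInverseEquivalences : InduceInverseEquivalences (homFunctor (RightEnd R T) R T)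
    (tensorFunctor (RightEnd R T) R T) P G := by
  have hcounit (X : ModuleCat.{u} Rᵐᵒᵖ) (hX : P X) :=
    h.generated.isIso_counit (isBalancedBimodule_rightEnd R T) hX
  refine .of_adjunction (BimodTensor.adjunction (RightEnd R T) R T)
    (h.equivalence.prop_obj h.resolving.summand) (fun N hN => ?_) hcounit fun N hN => ?_
  · obtain ⟨X, hX, ⟨e⟩⟩ := h.equivalence.exists_iso N hN
    have := hcounit X hX
    exact h.coresolving.summand ((tensorFunctor (RightEnd R T) R T).mapIso e ≪≫
      asIso ((BimodTensor.adjunction (RightEnd R T) R T).counit.app X)).retract hX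
  · obtain ⟨X, hX, ⟨e⟩⟩ := h.equivalence.exists_iso N hN
    exact isIso_unit_of_iso _ (hcounit X hX) e

/-- A module in `Ker Ext¹(-, P)` embeds in a power of `T`. -/
theorem exists_embedding (hcot : IsCompleteHereditaryCotorsionPair (leftExtPerp P) P)
    {X : ModuleCat.{u} Rᵐᵒᵖ} (hX : leftExtPerp P X) :
    ∃ (n : ℕ) (i : X →ₗ[Rᵐᵒᵖ] (Fin n → T)), Function.Injective i := by
  obtain ⟨A, Z, f, g, hA, hZ, hs⟩ := hcot.complete_right X hX.1
  -- Now `A` is in both classes of the cotorsion pair, so its presentation by a power of `T` splits.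
  have hA' := hcot.hereditary.extension f g hs hX hZ
  obtain ⟨n, π, hπ, hker⟩ := h.generated.generates A hA
  obtain ⟨r⟩ := (hA'.2 _ hker).nonempty_retract_right (isShortExact_ker hπ)
  have hr : Function.LeftInverse r.r.hom r.i.hom := fun a => congrArg (fun l => l.hom a) r.retract
  exact ⟨n, r.i.hom ∘ₗ f.hom, hr.injective.comp ((isShortExact_iff _ _).1 hs).1⟩

/-- The adjunction for `DT` must carry each class into the other. Both inclusions are instances of
the Ext-vanishing lemma, one with `DT` over `S` and one with `T` over `R`. -/
theorem induceInverseEquivalences_artinDual [Module.Finite k T]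
    (hbal : IsBalancedBimodule R (RightEnd R T) (ArtinDual k T))
    (hB : IsCompleteHereditaryCotorsionPair (leftExtPerp P) P)
    (hK : IsCompleteHereditaryCotorsionPair G (rightExtPerp G)) :
    InduceInverseEquivalences (homFunctor R (RightEnd R T) (ArtinDual k T))
      (tensorFunctor R (RightEnd R T) (ArtinDual k T)) (rightExtPerp G) (leftExtPerp P) := by
  have := finite_rightEnd k R T
  have hgen := h.isPowGenerated_artinDual (k := k) hK
  have hT := isBalancedBimodule_rightEnd R T
  refine .of_adjunction (BimodTensor.adjunction R (RightEnd R T) (ArtinDual k T))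
    (fun Y hY => ⟨hgen.finite_hom hbal hY, fun A hA => ?_⟩)
    (fun X hX => ⟨?_, fun N hN => ?_⟩) (fun Y hY => hgen.isIso_counit hbal hY) fun X hX => ?_
  · have : Module.Finite Rᵐᵒᵖ A := h.coresolving.le_fg _ hA
    let := moduleOfAlgebra k Rᵐᵒᵖ A
    have := isScalarTower_moduleOfAlgebra k Rᵐᵒᵖ A
    have : Module.Finite k A := Module.Finite.trans Rᵐᵒᵖ A
    -- The test module is `A = D Hom_S(N, DT)` with `N = Hom_R(T, A)` in `G`, and `N` is
    -- Ext-orthogonal to the class generated by `DT`.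
    obtain ⟨ev, hbij, hev⟩ := exists_eval_hom (k := k) (S := RightEnd R T) (R := R) (T := T) (A := A)
      ((ConcreteCategory.isIso_iff_bijective _).1 (h.generated.isIso_counit hT hA))
    refine hgen.extVanishes_hom hbal (fun Z hZ => ?_) ev hbij hev hY
    exact hZ.2 _ (h.equivalence.prop_obj h.resolving.summand _ hA)
  · have : Module.Finite Rᵐᵒᵖ X := hX.1
    have : Module.Finite (RightEnd R T)ᵐᵒᵖ (ArtinDual k T) :=
      Module.Finite.of_restrictScalars_finite k _ _
    exact BimodTensor.finite
  · have : Module.Finite Rᵐᵒᵖ X := hX.1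
    obtain ⟨A, hA, ⟨e⟩⟩ := h.equivalence.exists_iso N hN
    refine ExtVanishes.retract_left e.retract ?_
    -- Here `X ⊗ DT = D Hom_R(X, T)`, and `X` is Ext-orthogonal to `P` by definition.
    exact h.generated.extVanishes_hom hT (N := X) hX.2 evalTensor
      (bijective_evalTensor (RightEnd R T)) evalTensor_smul hA
  · have : Module.Finite Rᵐᵒᵖ X := hX.1
    obtain ⟨n, i, hi⟩ := h.exists_embedding hB hX
    rw [ConcreteCategory.isIso_iff_bijective]
    exact bijective_unit_artinDual (X := X) h.generated hT h.coresolving.prop_artinDual hX.2 i hi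

end IsWakamatsuEquivalence

end Main

end

theorem mainTheorem4 (k R T : Type u) [CommRing k] [IsArtinianRing k] [Ring R] [Algebra k R]
    [Module.Finite k R] [AddCommGroup T] [Module Rᵐᵒᵖ T] [Module k T] [IsScalarTower k Rᵐᵒᵖ T]
    (hT : IsWakamatsuTilting R T)
    (P : ObjectProperty (ModuleCat.{u} Rᵐᵒᵖ))
    (G : ObjectProperty (ModuleCat.{u} (RightEnd R T)ᵐᵒᵖ))
    (hPfin : IsCovariantlyFinite P) (hP : IsCoresolving P)
    (hGfin : IsContravariantlyFinite G) (hG : IsResolving G)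
    (hPG : InducesEquivalence (homFunctor (RightEnd R T) R T) P G)
    (hgen : IsExtProjectiveGenerator P (ModuleCat.of Rᵐᵒᵖ T)) :
    IsGoodWakamatsuTilting k R T := by
  have := hT.finite
  have : Module.Finite k T := Module.Finite.trans Rᵐᵒᵖ T
  have := finite_rightEnd k R T
  have : IsArtinianRing Rᵐᵒᵖ := IsArtinianRing.of_finite k Rᵐᵒᵖ
  have : IsArtinianRing (RightEnd R T)ᵐᵒᵖ := IsArtinianRing.of_finite k (RightEnd R T)ᵐᵒᵖ
  have hB := hP.isCompleteHereditaryCotorsionPair (hasEnoughFGInjectives k R) hPfin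
  have hK := hG.isCompleteHereditaryCotorsionPair (hasEnoughFGInjectives k (RightEnd R T)) hGfin
  have h : IsWakamatsuEquivalence P G := ⟨hP, hG, hgen.isPowGenerated hP, hPG⟩
  -- The double centralizer property enters through the identification of `R` with the endomorphism
  -- ring of `DT_S`.
  exact ⟨hT, leftExtPerp P, P, G, rightExtPerp G, hB, hK, h.induceInverseEquivalences,
    h.induceInverseEquivalences_artinDual
      (isBalancedBimodule_artinDual hT.doubleCentralizer) hB hK⟩
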